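/- **Notation.** Let $q$ be a prime power. For subspaces $X,Y\subseteq\mathbb F_q^n$ let $d_I(X,Y)=\max\{\dim X,\dim Y\}-\dim(X\cap Y)$, and let $\mathcal G_q(k,n)$ be the set of $k$-dimensional subspaces of $\mathbb F_q^n$. A constant-dimension code is a finite set $\mathbb C\subseteq\mathcal G_q(k,n)$; its minimum injection distance is $\min\{d_I(X,Y): X,Y\in\mathbb C,\ X\ne Y\}$. Put $\binom{m}{2}_q=\prod_{i=0}^{1}\frac{q^{m-i}-1}{q^{2-i}-1}$. *Ferrers diagrams and lifting.* For a binary vector $v$ of length $n$ and weight $k$ (an identifying vector) consider the $k\times n$ matrices in reduced row echelon form with pivots at the ones of $v$. Delete the $k$ pivot columns; the Ferrers diagram $\mathcal F_v$ consists of the positions (dots) in the remaining $k\times(n-k)$ array which lie to the right of the pivot of their row. A $k\times(n-k)$ matrix $T$ supported on $\mathcal F_v$ determines a unique echelon matrix; lifting $T$ (for $v$) means taking its row space, an element of $\mathcal G_q(k,n)$. For a right-justified diagram $\mathcal F$ and $d\ge1$, an FDMRD code for $\mathcal F$ with minimum rank distance $d$ is a linear space of matrices over $\mathbb F_q$, supported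 on $\mathcal F$, in which any two distinct elements differ by a matrix of rank at least $d$, and whose dimension equals $\min_{0\le i\le d-1}w_i$, where $w_i$ is the number of dots of $\mathcal F$ outside of the first $i$ rows and the rightmost $d-1-i$ columns. (For a full rectangle this is a linear MRD code.) **Construction A.** Let $k\ge4$, $s=\sum_{i=3}^k i=\frac{k^2+k-6}{2}$, $n\ge s+2+k=\frac{k^2+3k-2}{2}$, let $\ell=n-s$ if $n-s$ is odd and $\ell=n-s-1$ if $n-s$ is even, and suppose that $q^2+q+1\ge\ell$. Choose the following. 1. *Suffixes.* A partition of the binary vectors of length $n-s$ and weight $2$ into classes $P_1,\dots,P_\ell$, each consisting of $\lfloor (n-s)/2\rfloor$ vectors with pairwise disjoint positions of ones. 2. *Identifying vectors.* For every $r\ge 3$ let $v_{00}^r=(1\cdots10\cdots0)$ with $r$ ones, and for $4\le r\le k$ and $1\le j\le r-3$ let $v_{0j}^r=(000\,w_j^r\,\|\,v_{0,j-1}^{r-1})$, where $w_1^r,\dots,w_{r-3}^r$ are distinct vectors of $\mathbb F_2^{r-3}$ of weight $1$. For $i\in\{1,2,3\}$ and a suffix $y$ let $v_i(y)=(e_{4-i}^{(k)}\|e_{4-i}^{(k-1)}\|\cdots\|e_{4-i}^{(3)}\|y)$,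 where $e_t^{(r)}$ is the vector of length $r$ with a single one in position $t$. The identifying vectors are those of length $n$ among: $v_{00}^k$; $v_{0j}^k$ for $1\le j\le k-3$ (the set $\mathcal A_0^k$); and, for $i=1,2,3$, the vectors $v_i(y)$ with $y\in P_t$ (the set $\mathcal A_i^k$), where $t=1$ for $i=1$, $2\le t\le\min\{q+1,\ell\}$ for $i=2$, and $q+2\le t\le\ell$ for $i=3$. 3. *Pending blocks.* For the vectors in $\mathcal A_i^k$, $i\in\{1,2,3\}$, the dots outside of the last $n-s-2$ columns of the Ferrers diagram form the common pending block, a right-justified diagram with $\sum_{r=3}^{k-j}r+(i-1)$ dots in row $j$, $1\le j\le k-2$. It is filled as follows for $v_i(y)$, $y\in P_t$. The first $i-1$ entries of each of these rows are a tuple $a_t\in\mathbb F_q^{\,i-1}$ depending only on $t$, the same in each row, with $a_t\ne a_{t'}$ for different classes $t\neq t'$ belonging to the same $i$. The other entries of the block (a diagram with $\sum_{r=3}^{k-j}r$ dots in row $j$, $1\le j\le k-3$) are an element of an FDMRD code with minimum rank distance $k-3$ for that diagram (this code may depend on $t$), where different $y\in P_t$ get different elements. 4. *Codes.* For $v_{00}^k$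 and each vector in $\mathcal A_0^k$, an FDMRD code with minimum rank distance $k-1$ for its Ferrers diagram; all its elements are lifted. For each vector in $\mathcal A_1^k\cup\mathcal A_2^k\cup\mathcal A_3^k$, an FDMRD code with minimum rank distance $k-1$ for the dots in the last $n-s-2$ columns of its Ferrers diagram; each of its elements, together with the fixed filling of the pending block, is lifted. The code $\mathbb C^k$ is the set of all subspaces lifted in step 4. **Theorem.** Under these conditions ($k\ge4$, $n\ge\frac{k^2+3k-2}{2}$, $q^2+q+1\ge\ell$) all the choices in Construction A can be made, and for all such choices the code $\mathbb C^k$ is a constant-dimension code in $\mathcal G_q(k,n)$ with minimum injection distance exactly $k-1$ and cardinality $$|\mathbb C^k|=q^{2(n-k)}+\sum_{j=3}^{k-1}q^{2\left(n-\sum_{i=j}^{k}i\right)}+\binom{n-\frac{k^2+k-6}{2}}{2}_q .$$ -/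

import Mathlib

/-! ## Codes in the Grassmannian -/

/-- The injection distance `max {dim X, dim Y} - dim (X ∩ Y)` of two subspaces. -/
noncomputable def injDist {F : Type*} [Field F] {n : ℕ} (X Y : Submodule F (Fin n → F)) : ℕ :=
  max (Module.finrank F X) (Module.finrank F Y) - Module.finrank F (X ⊓ Y : Submodule F (Fin n → F))

/-- The `q`-ary Gaussian coefficient `∏_{i < k} (q^{n-i} - 1) / (q^{k-i} - 1)`. -/
def gaussCoeff (q : ℚ) (n k : ℕ) : ℚ :=
  ∏ i ∈ Finset.range k, (q ^ (n - i) - 1) / (q ^ (k - i) - 1)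

/-- `C` is an `(n, M, d, k)_q` constant-dimension code: a set of `M` subspaces of `F^n` of
dimension `k` whose minimum injection distance (an attained minimum) is `d`. -/
def IsConstDimCode {F : Type*} [Field F] (n : ℕ) (M : ℚ) (d k : ℕ)
    (C : Set (Submodule F (Fin n → F))) : Prop :=
  (∀ X ∈ C, Module.finrank F X = k) ∧ C.Finite ∧ (C.ncard : ℚ) = M ∧
    IsLeast {e | ∃ X ∈ C, ∃ Y ∈ C, X ≠ Y ∧ injDist X Y = e} d

/-! ## Ferrers diagram rank-metric codes

A diagram is a set of dots in an `m × ℓ` frame, rows counted from the top and columns from the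
left. Diagrams are right-justified, so that leading empty columns and empty rows at the bottom of
the frame are harmless: they change none of the notions below. -/

/-- The number `w_i` of dots which are neither in the first `i` rows nor in the rightmost
`d - 1 - i` columns. -/
def dotsOutside {m l : ℕ} (D : Finset (Fin m × Fin l)) (d i : ℕ) : ℕ :=
  (D.filter fun p => i ≤ (p.1 : ℕ) ∧ (p.2 : ℕ) + (d - 1 - i) < l).card

/-- The upper bound `min_{0 ≤ i ≤ d - 1} w_i` on the dimension of a Ferrers diagram rank-metric
code with minimum rank distance `d ≥ 1`. -/
noncomputable def ferrersBound {m l : ℕ} (D : Finset (Fin m × Fin l)) (d : ℕ) : ℕ :=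
  ⨅ i : Fin d, dotsOutside D d i

/-- `C` is a `[D, ρ, d]` Ferrers diagram rank-metric (FDRM) code. -/
structure IsFDRM {F : Type*} [Field F] {m l : ℕ} (D : Finset (Fin m × Fin l)) (ρ d : ℕ)
    (C : Submodule F (Matrix (Fin m) (Fin l) F)) : Prop where
  eq_zero : ∀ A ∈ C, ∀ i j, (i, j) ∉ D → A i j = 0
  finrank_eq : Module.finrank F C = ρ
  le_rank_sub : ∀ A ∈ C, ∀ B ∈ C, A ≠ B → d ≤ (A - B).rank

/-- A Ferrers diagram maximum rank distance (FDMRD) code with minimum rank distance `d`: an FDRM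
code whose dimension attains the upper bound. For a full diagram this is a linear MRD code. -/
def IsFDMRD {F : Type*} [Field F] {m l : ℕ} (D : Finset (Fin m × Fin l)) (d : ℕ)
    (C : Submodule F (Matrix (Fin m) (Fin l) F)) : Prop :=
  IsFDRM D (ferrersBound D d) d C

/-! ## Identifying vectors and lifting

A binary vector is represented by its support, the set of the positions `0, 1, 2, …` of its
ones. -/

/-- The position of the `i`-th one (`i = 0, 1, …`), i.e. the column of the `i`-th pivot. -/
noncomputable def pivotCol (v : Finset ℕ) (i : ℕ) : ℕ := Nat.nth (fun x => x ∈ v) i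

/-- The position of the `j`-th zero, i.e. the `j`-th column without pivot. -/
noncomputable def freeCol (v : Finset ℕ) (j : ℕ) : ℕ := Nat.nth (fun x => x ∉ v) j

/-- The Ferrers diagram of the identifying vector `v` of length `n` and weight `k`, in the
`k × (n - k)` frame whose columns are the columns of the reduced row echelon form without pivot:
row `i` has a dot in each of these columns to the right of its pivot. -/
noncomputable def ferrersDiagram (k n : ℕ) (v : Finset ℕ) : Finset (Fin k × Fin (n - k)) :=
  Finset.univ.filter fun p => pivotCol v p.1 < freeCol v p.2

/-- The `k × n` matrix in reduced row echelon form with identifying vector `v` and Ferrers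
tableaux form `T` (where `T` vanishes outside of the Ferrers diagram of `v`). -/
noncomputable def echelonMatrix {F : Type*} [Field F] {k n : ℕ} (v : Finset ℕ)
    (T : Matrix (Fin k) (Fin (n - k)) F) : Matrix (Fin k) (Fin n) F :=
  fun i c => (if (c : ℕ) = pivotCol v i then 1 else 0) +
    ∑ j : Fin (n - k), if (c : ℕ) = freeCol v j then T i j else 0

/-- The subspace of `F^n` with identifying vector `v` and Ferrers tableaux form `T`. -/
noncomputable def liftSubspace {F : Type*} [Field F] {k n : ℕ} (v : Finset ℕ)
    (T : Matrix (Fin k) (Fin (n - k)) F) : Submodule F (Fin n → F) :=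
  Submodule.span F (Set.range fun i => echelonMatrix v T i)

/-- The concatenation `(x || y)`, where the vector `x` has length `len`. -/
def concatVec (len : ℕ) (x y : Finset ℕ) : Finset ℕ :=
  x ∪ y.map (addRightEmbedding len)

/-! ## The identifying vectors of Construction A -/

/-- `s = ∑_{i=3}^{k} i`. -/
def sA (k : ℕ) : ℕ := ∑ i ∈ Finset.Icc 3 k, i

/-- The number `ℓ` of classes into which the vectors of length `m` and weight `2` are
partitioned. -/
def numClasses (m : ℕ) : ℕ := if Even m then m - 1 else m

/-- `P_1, …, P_ℓ` is a partition of the binary vectors of length `m` and weight `2` into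
`ℓ = numClasses m` classes, each of `⌊m/2⌋` vectors with pairwise disjoint positions of ones (a
one-factorization or near-one-factorization of the complete graph on `m` nodes). -/
structure IsOneFactorization (m : ℕ) (P : ℕ → Finset (Finset ℕ)) : Prop where
  mem : ∀ t ∈ Finset.Icc 1 (numClasses m), ∀ y ∈ P t, y ∈ (Finset.range m).powersetCard 2
  existsUnique : ∀ y ∈ (Finset.range m).powersetCard 2,
    ∃! t, t ∈ Finset.Icc 1 (numClasses m) ∧ y ∈ P t
  card_eq : ∀ t ∈ Finset.Icc 1 (numClasses m), (P t).card = m / 2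
  disjoint : ∀ t ∈ Finset.Icc 1 (numClasses m), ∀ y ∈ P t, ∀ y' ∈ P t, y ≠ y' → Disjoint y y'

/-- The vectors `v_{0j}^k`: `v_{00}^k = (1…10…0)` has `k` leading ones, and
`v_{0j}^k = (000 w_j^k || v_{0,j-1}^{k-1})`, where the prefix has length `k` and where `w r j` is
the position (from `0` on) of the only one of `w_j^r`. -/
def vZero (w : ℕ → ℕ → ℕ) : ℕ → ℕ → Finset ℕ
  | k, 0 => Finset.range k
  | 0, _ + 1 => ∅
  | k + 1, j + 1 => concatVec (k + 1) {3 + w (k + 1) (j + 1)} (vZero w k j)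

/-- The vector of `𝒜_i^k` (`i = 1, 2, 3`) with suffix `y`: prefixes of lengths `k, k-1, …, 3`,
each with a single one in position `4 - i` (counted from `1`), followed by `y`. -/
def vSuffix (i : ℕ) : ℕ → Finset ℕ → Finset ℕ
  | k + 3, y => concatVec (k + 3) {3 - i} (vSuffix i (k + 2) y)
  | _, y => y

/-- The `i` such that the suffixes in the class `P_t` are used in `𝒜_i^k`: `1` for `t = 1`, `2` for
`2 ≤ t ≤ q + 1` and `3` for `q + 2 ≤ t`. -/
def classLevel (q t : ℕ) : ℕ := if t ≤ 1 then 1 else if t ≤ q + 1 then 2 else 3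

/-! ## Pending blocks

The Ferrers tableaux of the vectors in `𝒜_i^k` have `n - k` columns. The last `n - s - 2` of them
come from the suffix, the first `s + 2 - k` from the prefixes; the dots in the latter form the
pending block, in which row `j` (`1 ≤ j ≤ k - 2`) has its rightmost `∑_{r=3}^{k-j} r + (i - 1)`
entries. -/

/-- `∑_{r=3}^{k-j} r` for the row with index `j - 1`. -/
def rowLen (k a : ℕ) : ℕ := ∑ r ∈ Finset.Icc 3 (k - (a + 1)), r

/-- The pending block without the first `i - 1` entries of each row: a diagram with `∑_{r=3}^{k-j} r`
dots in row `j` for `1 ≤ j ≤ k - 3`, and no dots below. -/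
def blockDiagram (k : ℕ) : Finset (Fin k × Fin (sA k + 2 - k)) :=
  Finset.univ.filter fun p => sA k + 2 - k ≤ (p.2 : ℕ) + rowLen k p.1

/-- The filling of the pending block of a vector in `𝒜_i^k`, as a matrix in the frame of the
Ferrers tableaux: the first `i - 1` entries of each of the first `k - 2` rows of the block are
`a 0, …, a (i - 2)`, and the other entries are those of `B`. -/
def pendingFill {F : Type*} [Field F] (k n i : ℕ) (a : ℕ → F)
    (B : Matrix (Fin k) (Fin (sA k + 2 - k)) F) : Matrix (Fin k) (Fin (n - k)) F :=
  fun r c =>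
    if hc : (c : ℕ) < sA k + 2 - k then
      if (r : ℕ) < k - 2 ∧ (c : ℕ) + rowLen k r < sA k + 2 - k ∧
          sA k + 2 - k ≤ (c : ℕ) + rowLen k r + (i - 1) then
        a ((c : ℕ) + rowLen k r + (i - 1) - (sA k + 2 - k))
      else B r ⟨c, hc⟩
    else 0

/-- The dots of the Ferrers diagram of `v` in the last `n - s - 2` columns. -/
noncomputable def lastDots (k n : ℕ) (v : Finset ℕ) : Finset (Fin k × Fin (n - k)) :=
  (ferrersDiagram k n v).filter fun p => n - k ≤ (p.2 : ℕ) + (n - sA k - 2)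

/-! ## The construction -/

/-- The choices which Construction A leaves open. -/
structure ConstructionA (F : Type*) [Field F] [Fintype F] (k n : ℕ) where
  /-- The classes `P_1, …, P_ℓ` of suffixes. -/
  P : ℕ → Finset (Finset ℕ)
  isOneFactorization : IsOneFactorization (n - sA k) P
  /-- The positions of the ones of the vectors `w_j^r` of length `r - 3`, for `4 ≤ r ≤ k`. -/
  w : ℕ → ℕ → ℕ
  w_lt : ∀ r ∈ Finset.Icc 4 k, ∀ j ∈ Finset.Icc 1 (r - 3), w r j < r - 3
  w_inj : ∀ r ∈ Finset.Icc 4 k, Set.InjOn (w r) (Finset.Icc 1 (r - 3) : Finset ℕ)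
  /-- The codes which are lifted for `v_{00}^k` (where it is an MRD code) and for the vectors
  `v_{0j}^k`, `1 ≤ j ≤ k - 3`. -/
  codeZero : ℕ → Submodule F (Matrix (Fin k) (Fin (n - k)) F)
  codeZero_isFDMRD : ∀ j ∈ Finset.range (k - 2),
    IsFDMRD (ferrersDiagram k n (vZero w k j)) (k - 1) (codeZero j)
  /-- The values of the first entries in each row of the pending blocks, one tuple for each
  class; only the first `i - 1` values are used in `𝒜_i^k`. -/
  label : ℕ → ℕ → F
  label_ne : ∀ t ∈ Finset.Icc 1 (numClasses (n - sA k)),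
    ∀ t' ∈ Finset.Icc 1 (numClasses (n - sA k)), t ≠ t' →
    classLevel (Fintype.card F) t = classLevel (Fintype.card F) t' →
    ∃ e < classLevel (Fintype.card F) t - 1, label t e ≠ label t' e
  /-- The FDMRD codes from which the other entries of the pending blocks are taken. -/
  blockCode : ℕ → Submodule F (Matrix (Fin k) (Fin (sA k + 2 - k)) F)
  blockCode_isFDMRD : ∀ t ∈ Finset.Icc 1 (numClasses (n - sA k)),
    IsFDMRD (blockDiagram k) (k - 3) (blockCode t)
  /-- The codeword in the pending block of the vector with suffix `y`; different vectors with
  suffixes from the same class get different codewords. -/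
  block : Finset ℕ → Matrix (Fin k) (Fin (sA k + 2 - k)) F
  block_mem : ∀ t ∈ Finset.Icc 1 (numClasses (n - sA k)), ∀ y ∈ P t, block y ∈ blockCode t
  block_inj : ∀ t ∈ Finset.Icc 1 (numClasses (n - sA k)), Set.InjOn block (P t)
  /-- The FDMRD codes on the dots in the last `n - s - 2` columns, for the vector with
  suffix `y`. -/
  codeSuffix : Finset ℕ → Submodule F (Matrix (Fin k) (Fin (n - k)) F)
  codeSuffix_isFDMRD : ∀ t ∈ Finset.Icc 1 (numClasses (n - sA k)), ∀ y ∈ P t,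
    IsFDMRD (lastDots k n (vSuffix (classLevel (Fintype.card F) t) k y)) (k - 1) (codeSuffix y)

namespace ConstructionA

/-- The lifted code of the vector `v_{0j}^k`: the lifted MRD code for `j = 0`, and a part of the
code of `𝒜_0^k` for `1 ≤ j ≤ k - 3`. -/
def partZero {F : Type*} [Field F] [Fintype F] {k n : ℕ} (A : ConstructionA F k n) (j : ℕ) :
    Set (Submodule F (Fin n → F)) :=
  {X | ∃ M ∈ A.codeZero j, X = liftSubspace (vZero A.w k j) M}

/-- The lifted code of the vector with suffix `y ∈ P_t`. -/
def partSuffix {F : Type*} [Field F] [Fintype F] {k n : ℕ} (A : ConstructionA F k n) (t : ℕ)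
    (y : Finset ℕ) : Set (Submodule F (Fin n → F)) :=
  {X | ∃ M ∈ A.codeSuffix y, X = liftSubspace (vSuffix (classLevel (Fintype.card F) t) k y)
    (pendingFill k n (classLevel (Fintype.card F) t) (A.label t) (A.block y) + M)}

/-- The code `ℂ^k`. -/
def code {F : Type*} [Field F] [Fintype F] {k n : ℕ} (A : ConstructionA F k n) :
    Set (Submodule F (Fin n → F)) :=
  (⋃ j ∈ Finset.range (k - 2), A.partZero j) ∪
    ⋃ t ∈ Finset.Icc 1 (numClasses (n - sA k)), ⋃ y ∈ A.P t, A.partSuffix t y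

end ConstructionA

/-!
The code `ℂ^k` has minimum injection distance at least `k - 1` if any two distinct elements
intersect in a space of dimension at most one.

A lifted subspace consists of the vectors whose free coordinates are the image under the Ferrers
tableau of their pivot coordinates, which are arbitrary (`mem_liftSubspace_iff`). Hence two subspaces
lifted for the same identifying vector have distance equal to the rank of the difference of their
tableaux (`finrank_inf_liftSubspace_add_rank`), which is at least `k - 1`. For two identifying
vectors, a vector of the intersection has its first nonzero coordinate at a common one of both, so
that the dimension of the intersection is at most the number of the common ones
(`finrank_inf_liftSubspace_le`). This number is at most one except for two vectors in the same
`𝒜_i^k`, whose prefixes coincide. In that case (`finrank_inf_vSuffix_le_one`) the coefficients, with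
respect to the rows of an echelon matrix, of a vector in the intersection annihilate the difference
of the two pending blocks. For suffixes in different classes the labels make the first `k - 2` rows
of the difference independent (`eq_zero_of_sum_mul_pendingFill_sub_eq_zero`), and the suffixes have
at most one common one. For suffixes in the same class the first `k - 3` rows are independent, and
the suffixes are disjoint. The distance `k - 1` is attained because a lifted MRD code is too large to
have minimum rank distance `k`.

The dimensions of the codes rest on the Singleton-type bound `finrank_le_dotsOutside`: a code that
attains the bound for the diagram without its first `d - 1` rows is an FDMRD code. Such codes are
obtained by shortening Gabidulin codes, which are needed only for minimum distance `k - 1`, i.e.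
for the linearized polynomials `α x + β x^q` (`exists_gabidulin`, `exists_isFDMRD`). The classes of
suffixes come from the round-robin schedule (`exists_isOneFactorization`). The suffixes contribute
`∑_y q^{2m - 3 - ∑ y}` elements in total, with `m = n - s`, which is the number of two-dimensional
subspaces of `F^m` counted by their pivots (`sum_pairs_pow_eq_gaussCoeff`).
-/

/-! ### Pivot columns and free columns -/

theorem pivotCol_mem {v : Finset ℕ} {i : ℕ} (hi : i < v.card) : pivotCol v i ∈ v :=
  Nat.nth_mem (p := fun x => x ∈ v) i fun hf => by
    have : hf.toFinset = v := by ext; simp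
    rwa [this]

theorem count_pivotCol {v : Finset ℕ} {i : ℕ} (hi : i < v.card) :
    Nat.count (fun x => x ∈ v) (pivotCol v i) = i :=
  Nat.count_nth fun hf => by
    have : hf.toFinset = v := by ext; simp
    rwa [this]

theorem pivotCol_count {v : Finset ℕ} {x : ℕ} (hx : x ∈ v) :
    pivotCol v (Nat.count (fun x => x ∈ v) x) = x :=
  Nat.nth_count (p := fun x => x ∈ v) hx

theorem infinite_notMem (v : Finset ℕ) : (Set.ofPred fun x => x ∉ v).Infinite :=
  v.finite_toSet.infinite_compl

theorem freeCol_notMem (v : Finset ℕ) (j : ℕ) : freeCol v j ∉ v :=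
  Nat.nth_mem_of_infinite (infinite_notMem v) j

theorem freeCol_count {v : Finset ℕ} {x : ℕ} (hx : x ∉ v) :
    freeCol v (Nat.count (fun x => x ∉ v) x) = x :=
  Nat.nth_count (p := fun x => x ∉ v) hx

theorem freeCol_injective (v : Finset ℕ) : Function.Injective (freeCol v) :=
  Nat.nth_injective (infinite_notMem v)

theorem count_mem_add_count_notMem (v : Finset ℕ) (c : ℕ) :
    Nat.count (fun x => x ∈ v) c + Nat.count (fun x => x ∉ v) c = c := by
  induction c with
  | zero => simp
  | succ c ih =>
    rw [Nat.count_succ, Nat.count_succ]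
    split_ifs <;> omega

theorem count_mem_eq_card {v : Finset ℕ} {n : ℕ} (hv : v ⊆ Finset.range n) :
    Nat.count (fun x => x ∈ v) n = v.card := by
  rw [Nat.count_eq_card_filter_range, Finset.filter_mem_eq_inter,
    Finset.inter_eq_right.2 hv]

/-- Row `i` of a Ferrers diagram starts in column `pivotCol v i - i`, because exactly `i` of the
columns before its pivot are pivot columns. -/
theorem pivotCol_lt_freeCol_iff {v : Finset ℕ} {i : ℕ} (hi : i < v.card) (j : ℕ) :
    pivotCol v i < freeCol v j ↔ pivotCol v i ≤ i + j := by
  have h1 : Nat.count (fun x => x ∉ v) (pivotCol v i + 1) ≤ j ↔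
      pivotCol v i + 1 ≤ freeCol v j :=
    Nat.count_le_iff_le_nth (infinite_notMem v)
  have h2 := count_mem_add_count_notMem v (pivotCol v i)
  rw [count_pivotCol hi] at h2
  rw [Nat.count_succ, if_neg (not_not.2 (pivotCol_mem hi))] at h1
  omega

theorem mem_ferrersDiagram {k n : ℕ} {v : Finset ℕ} (hc : v.card = k)
    (p : Fin k × Fin (n - k)) :
    p ∈ ferrersDiagram k n v ↔ pivotCol v p.1 ≤ p.1 + p.2 := by
  rw [ferrersDiagram, Finset.mem_filter, pivotCol_lt_freeCol_iff (by have := p.1.2; omega)]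
  simp

theorem pivotCol_injOn {v : Finset ℕ} {i j : ℕ} (hi : i < v.card) (hj : j < v.card)
    (h : pivotCol v i = pivotCol v j) : i = j := by
  rw [← count_pivotCol hi, h, count_pivotCol hj]

theorem pivotCol_lt_of_lt {v : Finset ℕ} {i j : ℕ} (hij : i < j) (hj : j < v.card) :
    pivotCol v i < pivotCol v j :=
  Nat.nth_lt_nth' (p := fun x => x ∈ v) hij fun hf => by
    have : hf.toFinset = v := by ext; simp
    rwa [this]

theorem pivotCol_add_le {v : Finset ℕ} (i d : ℕ) (h : i + d < v.card) :
    pivotCol v i + d ≤ pivotCol v (i + d) := by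
  induction d with
  | zero => simp
  | succ d ih =>
    have h1 := ih (by omega)
    have h2 := pivotCol_lt_of_lt (v := v) (show i + d < i + (d + 1) by omega) h
    omega

theorem freeCol_lt {k n : ℕ} {v : Finset ℕ} (hv : v ⊆ Finset.range n) (hc : v.card = k) {j : ℕ}
    (hj : j < n - k) : freeCol v j < n := by
  refine Nat.nth_lt_of_lt_count (p := fun x => x ∉ v) ?_
  have := count_mem_add_count_notMem v n
  rw [count_mem_eq_card hv, hc] at this
  omega

theorem pivotCol_lt {k n : ℕ} {v : Finset ℕ} (hv : v ⊆ Finset.range n) (hc : v.card = k) {i : ℕ}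
    (hi : i < k) : pivotCol v i < n :=
  Finset.mem_range.1 (hv (pivotCol_mem (hc ▸ hi)))

/-- The `i`-th pivot column as an index of a column. -/
noncomputable def pivotIdx {k n : ℕ} {v : Finset ℕ} (hv : v ⊆ Finset.range n) (hc : v.card = k)
    (i : Fin k) : Fin n :=
  ⟨pivotCol v i, pivotCol_lt hv hc i.2⟩

/-- The `j`-th column without pivot as an index of a column. -/
noncomputable def freeIdx {k n : ℕ} {v : Finset ℕ} (hv : v ⊆ Finset.range n) (hc : v.card = k)
    (j : Fin (n - k)) : Fin n :=
  ⟨freeCol v j, freeCol_lt hv hc j.2⟩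

theorem exists_pivotIdx_eq {k n : ℕ} {v : Finset ℕ} (hv : v ⊆ Finset.range n) (hc : v.card = k)
    {c : Fin n} (h : (c : ℕ) ∈ v) : ∃ i, c = pivotIdx hv hc i := by
  refine ⟨⟨Nat.count (fun x => x ∈ v) c, ?_⟩, Fin.ext (pivotCol_count h).symm⟩
  rw [← hc, ← count_mem_eq_card hv]
  exact Nat.count_strict_mono h c.2

theorem exists_freeIdx_eq {k n : ℕ} {v : Finset ℕ} (hv : v ⊆ Finset.range n) (hc : v.card = k)
    {c : Fin n} (h : (c : ℕ) ∉ v) : ∃ j, c = freeIdx hv hc j := by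
  refine ⟨⟨Nat.count (fun x => x ∉ v) c, ?_⟩, Fin.ext (freeCol_count h).symm⟩
  have h1 := Nat.count_strict_mono (p := fun x => x ∉ v) h c.2
  have h2 := count_mem_add_count_notMem v n
  rw [count_mem_eq_card hv, hc] at h2
  omega

/-! ### Subspaces in echelon form -/

section Lift

variable {F : Type*} [Field F] {k n : ℕ} {v : Finset ℕ} (hv : v ⊆ Finset.range n)
  (hc : v.card = k) (T T' : Matrix (Fin k) (Fin (n - k)) F)

theorem echelonMatrix_pivotIdx (i i' : Fin k) :
    echelonMatrix v T i (pivotIdx hv hc i') = if i' = i then 1 else 0 := by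
  have h : ∀ j : Fin (n - k), ((pivotIdx hv hc i' : Fin n) : ℕ) ≠ freeCol v j := fun j e =>
    freeCol_notMem v j (e ▸ pivotCol_mem (hc ▸ i'.2))
  have h2 : ((pivotIdx hv hc i' : Fin n) : ℕ) = pivotCol v i ↔ i' = i :=
    ⟨fun e => Fin.ext (pivotCol_injOn (hc ▸ i'.2) (hc ▸ i.2) e), fun e => e ▸ rfl⟩
  simp only [echelonMatrix, h, h2, if_false, Finset.sum_const_zero, add_zero]

theorem echelonMatrix_freeIdx (i : Fin k) (j : Fin (n - k)) :
    echelonMatrix v T i (freeIdx hv hc j) = T i j := by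
  have h : ((freeIdx hv hc j : Fin n) : ℕ) ≠ pivotCol v i := fun e =>
    freeCol_notMem v j ((show freeCol v j = _ from e) ▸ pivotCol_mem (hc ▸ i.2))
  have h2 : ∀ j' : Fin (n - k), ((freeIdx hv hc j : Fin n) : ℕ) = freeCol v j' ↔ j = j' :=
    fun j' => ⟨fun e => Fin.ext (freeCol_injective v e), fun e => e ▸ rfl⟩
  simp only [echelonMatrix, h, h2, if_false, zero_add, Finset.sum_ite_eq, Finset.mem_univ, if_true]

theorem vecMul_echelonMatrix_pivotIdx (c : Fin k → F) (i : Fin k) :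
    Matrix.vecMul c (echelonMatrix v T) (pivotIdx hv hc i) = c i := by
  simp [Matrix.vecMul, dotProduct, echelonMatrix_pivotIdx]

theorem vecMul_echelonMatrix_freeIdx (c : Fin k → F) (j : Fin (n - k)) :
    Matrix.vecMul c (echelonMatrix v T) (freeIdx hv hc j) = Matrix.vecMul c T j := by
  simp [Matrix.vecMul, dotProduct, echelonMatrix_freeIdx]

theorem liftSubspace_eq_range :
    liftSubspace v T = LinearMap.range (echelonMatrix v T).vecMulLinear := by
  rw [range_vecMulLinear]; rfl

/-- A lifted subspace is the graph of `T`: the free coordinates of its elements are determined by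
the pivot coordinates, which are arbitrary. -/
theorem mem_liftSubspace_iff (x : Fin n → F) :
    x ∈ liftSubspace v T ↔
      ∀ j, x (freeIdx hv hc j) = Matrix.vecMul (fun i => x (pivotIdx hv hc i)) T j := by
  rw [liftSubspace_eq_range, LinearMap.mem_range]
  constructor
  · rintro ⟨c, rfl⟩ j
    simp only [Matrix.vecMulLinear_apply, vecMul_echelonMatrix_freeIdx,
      vecMul_echelonMatrix_pivotIdx]
  · intro h
    refine ⟨fun i => x (pivotIdx hv hc i), funext fun c => ?_⟩
    by_cases hcv : (c : ℕ) ∈ v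
    · obtain ⟨i, rfl⟩ := exists_pivotIdx_eq hv hc hcv
      rw [Matrix.vecMulLinear_apply, vecMul_echelonMatrix_pivotIdx]
    · obtain ⟨j, rfl⟩ := exists_freeIdx_eq hv hc hcv
      rw [Matrix.vecMulLinear_apply, vecMul_echelonMatrix_freeIdx, h]

include hv hc in
theorem vecMulLinear_echelonMatrix_injective :
    Function.Injective (echelonMatrix v T).vecMulLinear := fun c c' h => funext fun i => by
  simpa only [Matrix.vecMulLinear_apply, vecMul_echelonMatrix_pivotIdx]
    using congrFun h (pivotIdx hv hc i)

end Lift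

theorem finrank_ker_vecMulLinear_add_rank {F : Type*} [Field F] {k l : ℕ}
    (A : Matrix (Fin k) (Fin l) F) :
    Module.finrank F (LinearMap.ker A.vecMulLinear) + A.rank = k := by
  have h2 := LinearMap.finrank_range_add_finrank_ker A.vecMulLinear
  rw [range_vecMulLinear, ← Matrix.rank_eq_finrank_span_row] at h2
  simp only [Module.finrank_fintype_fun_eq_card, Fintype.card_fin] at h2
  omega

section Lift

variable {F : Type*} [Field F] {k n : ℕ} {v : Finset ℕ} (hv : v ⊆ Finset.range n)
  (hc : v.card = k) (T T' : Matrix (Fin k) (Fin (n - k)) F)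

include hv hc

theorem finrank_liftSubspace : Module.finrank F (liftSubspace v T) = k := by
  rw [liftSubspace_eq_range,
    LinearMap.finrank_range_of_inj (vecMulLinear_echelonMatrix_injective hv hc T)]
  simp

theorem liftSubspace_injective :
    Function.Injective (liftSubspace v : Matrix (Fin k) (Fin (n - k)) F → _) := by
  intro T T' h
  ext i j
  have h1 : echelonMatrix v T i ∈ liftSubspace v T' := by
    rw [← h]; exact Submodule.subset_span ⟨i, rfl⟩
  have h2 := (mem_liftSubspace_iff hv hc T' _).1 h1 j
  rw [echelonMatrix_freeIdx] at h2
  rw [h2]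
  simp [Matrix.vecMul, dotProduct, echelonMatrix_pivotIdx]

theorem finrank_inf_liftSubspace_add_rank :
    Module.finrank F (liftSubspace v T ⊓ liftSubspace v T' : Submodule F (Fin n → F)) +
      (T - T').rank = k := by
  have h : liftSubspace v T ⊓ liftSubspace v T' =
      (LinearMap.ker (T - T').vecMulLinear).map (echelonMatrix v T).vecMulLinear := by
    ext x
    rw [Submodule.mem_inf, Submodule.mem_map, mem_liftSubspace_iff hv hc T',
      liftSubspace_eq_range, LinearMap.mem_range]
    have key : ∀ c : Fin k → F, (∀ j, Matrix.vecMul c T j = Matrix.vecMul c T' j) ↔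
        c ∈ LinearMap.ker (T - T').vecMulLinear := fun c => by
      rw [LinearMap.mem_ker, Matrix.vecMulLinear_apply, Matrix.vecMul_sub, sub_eq_zero]
      exact funext_iff.symm
    constructor
    · rintro ⟨⟨c, rfl⟩, h⟩
      simp only [Matrix.vecMulLinear_apply, vecMul_echelonMatrix_freeIdx,
        vecMul_echelonMatrix_pivotIdx] at h
      exact ⟨c, (key c).1 h, rfl⟩
    · rintro ⟨c, h, rfl⟩
      refine ⟨⟨c, rfl⟩, ?_⟩
      simp only [Matrix.vecMulLinear_apply, vecMul_echelonMatrix_freeIdx,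
        vecMul_echelonMatrix_pivotIdx]
      exact (key c).2 h
  rw [h, ← (Submodule.equivMapOfInjective _
    (vecMulLinear_echelonMatrix_injective hv hc T) _).finrank_eq]
  exact finrank_ker_vecMulLinear_add_rank _

/-- The first nonzero coordinate of an element of a lifted subspace is in a pivot column. -/
theorem apply_eq_zero_of_mem_liftSubspace
    (hT : ∀ i j, (i, j) ∉ ferrersDiagram k n v → T i j = 0) {x : Fin n → F}
    (hx : x ∈ liftSubspace v T) {c : Fin n} (hcv : (c : ℕ) ∉ v) (h : ∀ c' < c, x c' = 0) :
    x c = 0 := by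
  obtain ⟨j, rfl⟩ := exists_freeIdx_eq hv hc hcv
  rw [(mem_liftSubspace_iff hv hc T x).1 hx]
  rw [Matrix.vecMul, dotProduct]
  refine Finset.sum_eq_zero fun i _ => ?_
  by_cases hij : (i, j) ∈ ferrersDiagram k n v
  · rw [h (pivotIdx hv hc i) (Finset.mem_filter.1 hij).2, zero_mul]
  · rw [hT i j hij, mul_zero]

/-- An element of two lifted subspaces is determined by its coordinates at the common ones of the
two identifying vectors. -/
theorem eq_zero_of_mem_inf_liftSubspace {v' : Finset ℕ} (hv' : v' ⊆ Finset.range n)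
    (hc' : v'.card = k)
    (hT : ∀ i j, (i, j) ∉ ferrersDiagram k n v → T i j = 0)
    (hT' : ∀ i j, (i, j) ∉ ferrersDiagram k n v' → T' i j = 0)
    {x : Fin n → F} (hx : x ∈ liftSubspace v T) (hx' : x ∈ liftSubspace v' T')
    (h : ∀ c : Fin n, (c : ℕ) ∈ v ∩ v' → x c = 0) : x = 0 := by
  funext c
  induction c using WellFoundedLT.induction with
  | ind c ih =>
    by_cases h1 : (c : ℕ) ∈ v
    · by_cases h2 : (c : ℕ) ∈ v'
      · exact h c (Finset.mem_inter.2 ⟨h1, h2⟩)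
      · exact apply_eq_zero_of_mem_liftSubspace hv' hc' T' hT' hx' h2 ih
    · exact apply_eq_zero_of_mem_liftSubspace hv hc T hT hx h1 ih

end Lift

theorem finrank_le_card_of_forall_eq_zero {F : Type*} [Field F] {n : ℕ}
    (W : Submodule F (Fin n → F)) (S : Finset ℕ)
    (h : ∀ x ∈ W, (∀ c : Fin n, (c : ℕ) ∈ S → x c = 0) → x = 0) :
    Module.finrank F W ≤ S.card := by
  let f : W →ₗ[F] (S → F) :=
    LinearMap.pi fun p => if hp : (p : ℕ) < n then
      (LinearMap.proj (⟨p, hp⟩ : Fin n)).comp W.subtype else 0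
  have hf : Function.Injective f := by
    rw [← LinearMap.ker_eq_bot, LinearMap.ker_eq_bot']
    rintro ⟨x, hx⟩ h0
    refine Subtype.ext (h x hx fun c hcS => ?_)
    have := congrFun h0 ⟨c, hcS⟩
    simpa [f] using this
  simpa using LinearMap.finrank_le_finrank_of_injective hf

/-- The dimension of the intersection of two lifted subspaces is at most the number of common ones
of their identifying vectors. -/
theorem finrank_inf_liftSubspace_le {F : Type*} [Field F] {k n : ℕ} {v v' : Finset ℕ}
    (hv : v ⊆ Finset.range n) (hc : v.card = k) (hv' : v' ⊆ Finset.range n) (hc' : v'.card = k)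
    {T T' : Matrix (Fin k) (Fin (n - k)) F}
    (hT : ∀ i j, (i, j) ∉ ferrersDiagram k n v → T i j = 0)
    (hT' : ∀ i j, (i, j) ∉ ferrersDiagram k n v' → T' i j = 0) :
    Module.finrank F (liftSubspace v T ⊓ liftSubspace v' T' : Submodule F (Fin n → F)) ≤
      (v ∩ v').card :=
  finrank_le_card_of_forall_eq_zero _ _ fun _ hx h =>
    eq_zero_of_mem_inf_liftSubspace hv hc T T' hv' hc' hT hT' hx.1 hx.2 h

/-! ### Bounds and constructions for Ferrers diagram codes -/

section Singleton

variable {F : Type*} [Field F] {m l : ℕ}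

theorem rank_add_le_add_rank (A B : Matrix (Fin m) (Fin l) F) :
    (A + B).rank ≤ A.rank + B.rank := by
  rw [Matrix.rank, Matrix.rank, Matrix.rank, Matrix.mulVecLin_add]
  refine (Submodule.finrank_mono (LinearMap.range_add_le _ _)).trans ?_
  exact Submodule.finrank_add_le_finrank_add_finrank _ _

/-- A matrix whose nonzero entries are covered by `i` rows and `e` columns has rank at most
`i + e`. -/
theorem rank_le_of_forall_eq_zero (A : Matrix (Fin m) (Fin l) F) (i e : ℕ)
    (h : ∀ (r : Fin m) (c : Fin l), i ≤ (r : ℕ) → (c : ℕ) + e < l → A r c = 0) :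
    A.rank ≤ i + e := by
  classical
  -- the indicators of the first `i` rows and of the last `e` columns
  let w : Fin m → F := fun r => if (r : ℕ) < i then 1 else 0
  let u : Fin l → F := fun c => if (c : ℕ) + e < l then 0 else 1
  have hA : A = Matrix.diagonal w * A + (Matrix.diagonal (1 - w) * A) * Matrix.diagonal u := by
    ext r c
    rw [Matrix.add_apply, Matrix.mul_diagonal, Matrix.diagonal_mul, Matrix.diagonal_mul]
    by_cases h1 : (r : ℕ) < i
    · simp [w, h1]
    · by_cases h2 : (c : ℕ) + e < l
      · simp [w, u, h1, h2, h r c (by omega) h2]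
      · simp [w, u, h1, h2]
  have h1 : (Matrix.diagonal w * A).rank ≤ i := by
    refine (Matrix.rank_mul_le_left _ _).trans ?_
    rw [Matrix.rank_diagonal, Fintype.card_subtype]
    calc (Finset.univ.filter fun r => w r ≠ 0).card ≤ (Finset.range i).card :=
          Finset.card_le_card_of_injOn (fun r : Fin m => (r : ℕ)) (fun r hr => by
            simpa [w] using hr) fun _ _ _ _ e => Fin.ext e
      _ = i := Finset.card_range i
  have h2 : ((Matrix.diagonal (1 - w) * A) * Matrix.diagonal u).rank ≤ e := by
    refine (Matrix.rank_mul_le_right _ _).trans ?_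
    rw [Matrix.rank_diagonal, Fintype.card_subtype]
    calc (Finset.univ.filter fun c => u c ≠ 0).card ≤ (Finset.Ico (l - e) l).card :=
          Finset.card_le_card_of_injOn (fun c : Fin l => (c : ℕ)) (fun c hc => by
            have : l ≤ (c : ℕ) + e := by simpa [u] using hc
            have := c.2
            simp only [Finset.coe_Ico, Set.mem_Ico]
            omega) fun _ _ _ _ e => Fin.ext e
      _ ≤ e := by rw [Nat.card_Ico]; omega
  rw [hA]
  exact (rank_add_le_add_rank _ _).trans (add_le_add h1 h2)

/-- The Singleton-type bound: a codeword vanishing on the dots outside of the first `i` rows and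
the rightmost `d - 1 - i` columns has rank less than `d`. -/
theorem finrank_le_dotsOutside {D : Finset (Fin m × Fin l)} {d i : ℕ} (hi : i < d)
    {C : Submodule F (Matrix (Fin m) (Fin l) F)}
    (hD : ∀ A ∈ C, ∀ i j, (i, j) ∉ D → A i j = 0)
    (hC : ∀ A ∈ C, A ≠ 0 → d ≤ A.rank) :
    Module.finrank F C ≤ dotsOutside D d i := by
  set S := D.filter fun p => i ≤ (p.1 : ℕ) ∧ (p.2 : ℕ) + (d - 1 - i) < l with hS
  let f : C →ₗ[F] (S → F) :=
    { toFun := fun A p => A.1 p.1.1 p.1.2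
      map_add' := fun _ _ => rfl
      map_smul' := fun _ _ => rfl }
  have hf : Function.Injective f := by
    rw [← LinearMap.ker_eq_bot, LinearMap.ker_eq_bot']
    rintro ⟨A, hA⟩ h0
    by_contra hne
    have h1 := hC A hA fun e => hne (Subtype.ext e)
    have h2 := rank_le_of_forall_eq_zero A i (d - 1 - i) fun r c hr hc => by
      by_cases hrc : (r, c) ∈ D
      · exact congrFun h0 ⟨(r, c), by rw [hS, Finset.mem_filter]; exact ⟨hrc, hr, hc⟩⟩
      · exact hD A hA r c hrc
    omega
  have := LinearMap.finrank_le_finrank_of_injective hf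
  rw [Module.finrank_fintype_fun_eq_card, Fintype.card_coe] at this
  exact this

theorem IsFDRM.le_rank {D : Finset (Fin m × Fin l)} {ρ d : ℕ}
    {C : Submodule F (Matrix (Fin m) (Fin l) F)} (h : IsFDRM D ρ d C) {A : Matrix _ _ F}
    (hA : A ∈ C) (hA0 : A ≠ 0) : d ≤ A.rank := by
  simpa using h.le_rank_sub A hA 0 C.zero_mem hA0

theorem ferrersBound_le {D : Finset (Fin m × Fin l)} {d i : ℕ} (hi : i < d) :
    ferrersBound D d ≤ dotsOutside D d i :=
  ciInf_le (OrderBot.bddBelow _) (⟨i, hi⟩ : Fin d)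

/-- A code which has as many dimensions as there are dots outside of the first `d - 1` rows attains
the upper bound, since it satisfies all the other bounds as well. -/
theorem isFDMRD_of_dotsOutside_le {D : Finset (Fin m × Fin l)} {d : ℕ} (hd : 1 ≤ d)
    {C : Submodule F (Matrix (Fin m) (Fin l) F)}
    (hD : ∀ A ∈ C, ∀ i j, (i, j) ∉ D → A i j = 0)
    (hC : ∀ A ∈ C, A ≠ 0 → d ≤ A.rank)
    (hdim : dotsOutside D d (d - 1) ≤ Module.finrank F C) :
    IsFDMRD D d C ∧ ferrersBound D d = dotsOutside D d (d - 1) := by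
  have h1 : ferrersBound D d = dotsOutside D d (d - 1) := by
    refine le_antisymm (ferrersBound_le (by omega)) ?_
    have : Nonempty (Fin d) := ⟨⟨0, by omega⟩⟩
    exact le_ciInf fun i => hdim.trans (finrank_le_dotsOutside i.2 hD hC)
  refine ⟨⟨hD, ?_, fun A hA B hB hAB => hC _ (C.sub_mem hA hB) (sub_ne_zero.2 hAB)⟩, h1⟩
  rw [h1]
  exact le_antisymm (finrank_le_dotsOutside (by omega) hD hC) hdim

end Singleton

section Gabidulin

open Polynomial in
theorem mem_range_algebraMap_of_pow_card_eq {F K : Type*} [Field F] [Fintype F] [Field K]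
    [Algebra F K] {x : K} (hx : x ^ Fintype.card F = x) : ∃ a, algebraMap F K a = x := by
  classical
  by_contra! hcon
  have hq := Fintype.one_lt_card (α := F)
  set S : Finset K := insert x (Finset.univ.image (algebraMap F K)) with hS
  have hsub : S.val ⊆ (X ^ Fintype.card F - X : K[X]).roots := by
    intro y hy
    rw [mem_roots (FiniteField.X_pow_card_sub_X_ne_zero K hq), IsRoot.def, eval_sub, eval_pow,
      eval_X, sub_eq_zero]
    rw [Finset.mem_val, hS, Finset.mem_insert, Finset.mem_image] at hy
    rcases hy with rfl | ⟨a, -, rfl⟩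
    · exact hx
    · rw [← map_pow, FiniteField.pow_card]
  have hcard := card_le_degree_of_subset_roots hsub
  rw [FiniteField.X_pow_card_sub_X_natDegree_eq K hq, hS, Finset.card_insert_of_notMem,
    Finset.card_image_of_injective _ (algebraMap F K).injective, Finset.card_univ] at hcard
  · omega
  · simpa using hcon

/-- The kernel of a nonzero linearized polynomial `α x + β x^q` is at most one-dimensional: the
quotient of two of its nonzero elements is fixed by the Frobenius. -/
theorem finrank_le_one_of_forall_linearized {F K : Type*} [Field F] [Fintype F] [Field K]
    [Algebra F K] {α β : K} (h : (α, β) ≠ 0) (W : Submodule F K)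
    (hW : ∀ u ∈ W, α * u + β * u ^ Fintype.card F = 0) : Module.finrank F W ≤ 1 := by
  by_cases hbot : W = ⊥
  · subst hbot; simp
  obtain ⟨u, hu, hu0⟩ := W.ne_bot_iff.1 hbot
  refine finrank_le_one (⟨u, hu⟩ : W) fun ⟨u', hu'⟩ => ?_
  have e1 := hW u hu
  have e2 := hW u' hu'
  have hβ : β ≠ 0 := by
    rintro rfl
    refine h (Prod.ext ?_ rfl)
    simpa [hu0] using e1
  have e3 : β * (u * u' ^ Fintype.card F) = β * (u' * u ^ Fintype.card F) := by
    linear_combination u * e2 - u' * e1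
  have e4 := mul_left_cancel₀ hβ e3
  obtain ⟨a, ha⟩ := mem_range_algebraMap_of_pow_card_eq (F := F) (x := u' / u) (by
    rw [div_pow, div_eq_div_iff (pow_ne_zero _ hu0) hu0]
    linear_combination e4)
  refine ⟨a, Subtype.ext ?_⟩
  change a • u = u'
  rw [Algebra.smul_def, ha, div_mul_cancel₀ _ hu0]

theorem exists_algebra_finrank_eq (F : Type*) [Field F] [Fintype F] {N : ℕ} (hN : N ≠ 0) :
    ∃ (K : Type) (_ : Field K) (_ : Algebra F K), Module.finrank F K = N := by
  obtain ⟨p, hp⟩ := CharP.exists F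
  have : Fact p.Prime := ⟨CharP.char_is_prime F p⟩
  have : NeZero N := ⟨hN⟩
  exact ⟨FiniteField.Extension F p N, inferInstance, inferInstance,
    FiniteField.finrank_extension F p N⟩

/-- The Gabidulin code of `k × N` matrices with minimum rank distance `k - 1`, as an injective
linear map from its `2N`-dimensional message space to `k × L` matrices, `N ≤ L`, supported on the
last `N` columns: the rows are the coordinate vectors of the values of `α x + β x^q`, `α` and `β`
in the field with `q^N` elements, at `k` linearly independent points. -/
theorem exists_gabidulin (F : Type*) [Field F] [Fintype F] {k N L : ℕ} (hk : 2 ≤ k) (hkN : k ≤ N)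
    (hNL : N ≤ L) :
    ∃ (V : Type) (_ : AddCommGroup V) (_ : Module F V) (f : V →ₗ[F] Matrix (Fin k) (Fin L) F),
      Module.finrank F V = 2 * N ∧ (∀ x ≠ 0, k - 1 ≤ (f x).rank) ∧
      ∀ x r (c : Fin L), (c : ℕ) + N < L → f x r c = 0 := by
  obtain ⟨K, _, _, hK⟩ := exists_algebra_finrank_eq F (show N ≠ 0 by omega)
  have : FiniteDimensional F K := Module.finite_of_finrank_pos (by omega)
  let e : K ≃ₗ[F] (Fin N → F) := LinearEquiv.ofFinrankEq _ _ (by simpa using hK)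
  let b := Module.finBasisOfFinrankEq F K hK
  let g : Fin k → K := fun r => b (Fin.castLE hkN r)
  have hg : LinearIndependent F g := b.linearIndependent.comp _ (Fin.castLE_injective hkN)
  let frob := FiniteField.frobeniusAlgHom F K
  let f : K × K →ₗ[F] Matrix (Fin k) (Fin L) F :=
    { toFun := fun x => Matrix.of fun r c => if h : L - N ≤ c then
          e (x.1 * g r + x.2 * frob (g r)) ⟨c - (L - N), by have := c.2; omega⟩ else 0
      map_add' := fun x y => by
        ext r c
        simp only [Matrix.add_apply, Matrix.of_apply]
        split_ifs
        · rw [← Pi.add_apply, ← map_add]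
          refine congrFun (congrArg e ?_) _
          simp only [Prod.fst_add, Prod.snd_add]
          ring
        · simp
      map_smul' := fun a x => by
        ext r c
        simp only [Matrix.smul_apply, Matrix.of_apply, RingHom.id_apply]
        split_ifs
        · rw [← Pi.smul_apply, ← map_smul]
          refine congrFun (congrArg e ?_) _
          simp only [Prod.smul_fst, Prod.smul_snd, smul_add, smul_mul_assoc]
        · simp }
  have hf : ∀ x r (c : Fin L), f x r c = if h : L - N ≤ c then
      e (x.1 * g r + x.2 * frob (g r)) ⟨c - (L - N), by have := c.2; omega⟩ else 0 :=
    fun _ _ _ => rfl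
  refine ⟨K × K, inferInstance, inferInstance, f, ?_, ?_, ?_⟩
  · rw [Module.finrank_prod, hK]; omega
  · intro x hx
    have h1 := finrank_ker_vecMulLinear_add_rank (f x)
    -- a combination of the rows vanishes only if the linearized polynomial vanishes at the
    -- corresponding combination of the points
    have h2 : Module.finrank F (LinearMap.ker (f x).vecMulLinear) ≤ 1 := by
      let s : (Fin k → F) →ₗ[F] K := Fintype.linearCombination F g
      have hs : Function.Injective s := by
        simpa [s, LinearMap.ker_eq_bot] using hg.fintypeLinearCombination_injective
      rw [(Submodule.equivMapOfInjective s hs _).finrank_eq]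
      refine finrank_le_one_of_forall_linearized (α := x.1) (β := x.2) hx _ ?_
      rintro _ ⟨c, hc, rfl⟩
      have h3 : e (x.1 * s c + x.2 * frob (s c)) = 0 := by
        funext j
        have h4 := congrFun (LinearMap.mem_ker.1 hc)
          ⟨j + (L - N), by have := j.2; omega⟩
        rw [Matrix.vecMulLinear_apply, Matrix.vecMul, dotProduct] at h4
        simp only [hf, Nat.le_add_left, dif_pos, Nat.add_sub_cancel] at h4
        rw [Pi.zero_apply, ← Pi.zero_apply (M := fun _ => F) _, ← h4]
        simp only [s, Fintype.linearCombination_apply, map_sum, Finset.mul_sum, map_smul,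
          ← Finset.sum_add_distrib, mul_smul_comm, ← smul_add, Finset.sum_apply, Pi.smul_apply,
          smul_eq_mul]
      exact e.map_eq_zero_iff.1 h3
    omega
  · intro x r c hc
    rw [hf, dif_neg (by omega)]

/-- Shortening a Gabidulin code gives an FDMRD code with minimum rank distance `k - 1` for each
diagram with `k` rows in which the first `k - 2` rows contain the last `N ≥ k` columns of the frame
while the last two rows are contained in these columns. -/
theorem exists_isFDMRD (F : Type*) [Field F] [Fintype F] {k N L : ℕ} (hk : 2 ≤ k) (hkN : k ≤ N)
    (hNL : N ≤ L) (D : Finset (Fin k × Fin L))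
    (h1 : ∀ p : Fin k × Fin L, (p.1 : ℕ) < k - 2 → L ≤ (p.2 : ℕ) + N → p ∈ D)
    (h2 : ∀ p ∈ D, k - 2 ≤ (p.1 : ℕ) → L ≤ (p.2 : ℕ) + N) :
    (∃ C : Submodule F (Matrix (Fin k) (Fin L) F), IsFDMRD D (k - 1) C) ∧
      ferrersBound D (k - 1) = dotsOutside D (k - 1) (k - 2) := by
  obtain ⟨V, _, _, f, hV, hrank, hsupp⟩ := exists_gabidulin F hk hkN hNL
  have : FiniteDimensional F V := Module.finite_of_finrank_pos (by omega)
  have hinj : Function.Injective f := by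
    rw [← LinearMap.ker_eq_bot, LinearMap.ker_eq_bot']
    intro x hx
    by_contra hne
    have := hrank x hne
    rw [hx, Matrix.rank_zero] at this
    omega
  let Z : Finset (Fin k × Fin L) :=
    Finset.univ.filter fun p => p ∉ D ∧ L ≤ (p.2 : ℕ) + N
  -- the words of the shortened code vanish in the positions `Z`
  let z : V →ₗ[F] (Z → F) :=
    { toFun := fun x p => f x p.1.1 p.1.2
      map_add' := fun x y => by ext p; simp
      map_smul' := fun a x => by ext p; simp }
  have hD : ∀ A ∈ (LinearMap.ker z).map f, ∀ i j, (i, j) ∉ D → A i j = 0 := by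
    rintro _ ⟨x, hx, rfl⟩ i j hij
    by_cases hj : L ≤ (j : ℕ) + N
    · exact congrFun (LinearMap.mem_ker.1 hx) ⟨(i, j), by simp [Z, hij, hj]⟩
    · exact hsupp x i j (by omega)
  have hC : ∀ A ∈ (LinearMap.ker z).map f, A ≠ 0 → k - 1 ≤ A.rank := by
    rintro _ ⟨x, hx, rfl⟩ hne
    exact hrank x fun h => hne (by rw [h, map_zero])
  have hdim : dotsOutside D (k - 1) (k - 1 - 1) ≤ Module.finrank F ((LinearMap.ker z).map f) := by
    rw [← (Submodule.equivMapOfInjective f hinj _).finrank_eq]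
    have e1 := LinearMap.finrank_range_add_finrank_ker z
    have e2 : Module.finrank F (LinearMap.range z) ≤ Z.card := by
      simpa using Submodule.finrank_le (LinearMap.range z)
    have e3 : Z.card + dotsOutside D (k - 1) (k - 1 - 1) ≤ 2 * N := by
      rw [dotsOutside, ← Finset.card_union_of_disjoint]
      · calc _ ≤ (Finset.Ico (k - 2) k ×ˢ Finset.Ico (L - N) L).card := by
              refine Finset.card_le_card_of_injOn (fun p => ((p.1 : ℕ), (p.2 : ℕ))) ?_ ?_
              · rintro ⟨i, j⟩ hp
                have hi := i.2
                have hj := j.2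
                simp only [Finset.coe_union, Finset.coe_filter, Set.mem_union, Set.mem_ofPred_eq,
                  Z, Finset.mem_univ, true_and] at hp
                simp only [Finset.coe_product, Finset.coe_Ico, Set.mem_prod, Set.mem_Ico]
                rcases hp with ⟨ha, hb⟩ | ⟨ha, hb, -⟩
                · have : ¬ (i : ℕ) < k - 2 := fun hlt => ha (h1 (i, j) hlt hb)
                  omega
                · have := h2 (i, j) ha (by simpa [Nat.sub_sub] using hb)
                  simp only at this
                  omega
              · rintro ⟨i, j⟩ - ⟨i', j'⟩ - h
                simpa [Fin.ext_iff] using h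
          _ = 2 * N := by
              rw [Finset.card_product, Nat.card_Ico, Nat.card_Ico]
              congr 1 <;> omega
      · rw [Finset.disjoint_left]
        intro p hp hp'
        exact (Finset.mem_filter.1 hp).2.1 (Finset.mem_filter.1 hp').1
    omega
  obtain ⟨e1, e2⟩ := isFDMRD_of_dotsOutside_le (by omega) hD hC hdim
  exact ⟨⟨_, e1⟩, e2⟩

end Gabidulin

/-! ### The identifying vectors -/

theorem pivotCol_eq {v : Finset ℕ} {p i : ℕ} (hp : p ∈ v) (h : Nat.count (fun x => x ∈ v) p = i) :
    pivotCol v i = p := by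
  rw [← h, pivotCol_count hp]

theorem count_congr_of_lt {p q : ℕ → Prop} [DecidablePred p] [DecidablePred q] {s : ℕ}
    (h : ∀ c < s, p c ↔ q c) : Nat.count p s = Nat.count q s := by
  rw [Nat.count_eq_card_filter_range, Nat.count_eq_card_filter_range]
  congr 1
  exact Finset.filter_congr fun c hc => h c (Finset.mem_range.1 hc)

theorem nth_congr_of_lt_count {p q : ℕ → Prop} [DecidablePred p] [DecidablePred q] {s i : ℕ}
    (h : ∀ c < s, p c ↔ q c) (hi : i < Nat.count p s) : Nat.nth p i = Nat.nth q i := by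
  have h1 : Nat.nth p i < s := Nat.nth_lt_of_lt_count hi
  have h2 : p (Nat.nth p i) := Nat.nth_mem i fun hf =>
    hi.trans_le (Nat.count_le_card hf s)
  have h3 : Nat.count p (Nat.nth p i) = i := Nat.count_nth fun hf =>
    hi.trans_le (Nat.count_le_card hf s)
  have h4 : Nat.count q (Nat.nth p i) = i := by
    rw [← h3, h3]
    exact (count_congr_of_lt fun c hc => (h c (hc.trans h1)).symm).trans h3
  rw [← Nat.nth_count ((h _ h1).1 h2), h4]

section Concat

variable {len : ℕ} {x y x' y' : Finset ℕ}

theorem mem_concatVec {c : ℕ} : c ∈ concatVec len x y ↔ c ∈ x ∨ len ≤ c ∧ c - len ∈ y := by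
  simp only [concatVec, Finset.mem_union, Finset.mem_map, addRightEmbedding_apply]
  refine or_congr_right ⟨?_, fun ⟨h1, h2⟩ => ⟨c - len, h2, by omega⟩⟩
  rintro ⟨a, ha, rfl⟩
  exact ⟨by omega, by simpa using ha⟩

theorem mem_concatVec_of_lt {c : ℕ} (hc : c < len) : c ∈ concatVec len x y ↔ c ∈ x := by
  simp [mem_concatVec, hc.not_ge]

theorem card_concatVec (hx : x ⊆ Finset.range len) :
    (concatVec len x y).card = x.card + y.card := by
  rw [concatVec, Finset.card_union_of_disjoint, Finset.card_map]
  rw [Finset.disjoint_left]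
  intro c hc hc'
  obtain ⟨a, -, rfl⟩ := Finset.mem_map.1 hc'
  have := Finset.mem_range.1 (hx hc)
  simp at this

theorem concatVec_inter (hx : x ⊆ Finset.range len) (hx' : x' ⊆ Finset.range len) :
    concatVec len x y ∩ concatVec len x' y' = concatVec len (x ∩ x') (y ∩ y') := by
  ext c
  have h1 : c ∈ x → c < len := fun h => Finset.mem_range.1 (hx h)
  have h2 : c ∈ x' → c < len := fun h => Finset.mem_range.1 (hx' h)
  simp only [Finset.mem_inter, mem_concatVec]
  grind

theorem concatVec_subset {m : ℕ} (hx : x ⊆ Finset.range len) (hy : y ⊆ Finset.range m) :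
    concatVec len x y ⊆ Finset.range (len + m) := by
  intro c hc
  rw [Finset.mem_range]
  rcases mem_concatVec.1 hc with h | ⟨h1, h2⟩
  · have := Finset.mem_range.1 (hx h); omega
  · have := Finset.mem_range.1 (hy h2); omega

theorem concatVec_assoc (a b : ℕ) (x y z : Finset ℕ) :
    concatVec a x (concatVec b y z) = concatVec (a + b) (concatVec a x y) z := by
  ext c
  have h1 : a ≤ c ∧ b ≤ c - a ↔ a + b ≤ c := by omega
  simp only [mem_concatVec, ← h1, Nat.sub_add_eq]
  tauto

theorem count_concatVec (hx : x ⊆ Finset.range len) (c : ℕ) :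
    Nat.count (fun a => a ∈ concatVec len x y) (len + c) =
      x.card + Nat.count (fun a => a ∈ y) c := by
  rw [Nat.count_add]
  congr 1
  · rw [← count_mem_eq_card hx]
    refine count_congr_of_lt fun a ha => ?_
    rw [mem_concatVec_of_lt ha]
  · refine count_congr_of_lt fun a _ => ?_
    rw [mem_concatVec, Nat.add_sub_cancel_left]
    have : len + a ∉ x := fun h => by simpa using hx h
    simp [this]

theorem pivotCol_concatVec_add (hx : x ⊆ Finset.range len) {i : ℕ} (hi : i < y.card) :
    pivotCol (concatVec len x y) (x.card + i) = len + pivotCol y i := by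
  refine pivotCol_eq (mem_concatVec.2 (Or.inr ⟨by omega, ?_⟩)) ?_
  · rw [Nat.add_sub_cancel_left]; exact pivotCol_mem hi
  · rw [count_concatVec hx, count_pivotCol hi]

theorem pivotCol_concatVec_of_lt (hx : x ⊆ Finset.range len) {i : ℕ} (hi : i < x.card) :
    pivotCol (concatVec len x y) i = pivotCol x i := by
  refine (nth_congr_of_lt_count (s := len) (fun a ha => ?_) ?_).symm
  · rw [mem_concatVec_of_lt ha]
  · rwa [count_mem_eq_card hx]

/-- The free columns in the prefix do not depend on the suffix. -/
theorem freeCol_concatVec_of_lt (hx : x ⊆ Finset.range len) {j : ℕ} (hj : j + x.card < len) :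
    freeCol (concatVec len x y) j = freeCol x j := by
  refine (nth_congr_of_lt_count (s := len) (fun a ha => ?_) ?_).symm
  · rw [mem_concatVec_of_lt ha]
  · have := count_mem_add_count_notMem x len
    rw [count_mem_eq_card hx] at this
    omega

theorem pivotCol_singleton (a : ℕ) : pivotCol {a} 0 = a :=
  Finset.mem_singleton.1 (pivotCol_mem (v := {a}) (by simp))

theorem pivotCol_pair {a b : ℕ} (h : a < b) : pivotCol {a, b} 0 = a ∧ pivotCol {a, b} 1 = b := by
  have hc : ({a, b} : Finset ℕ).card = 2 := Finset.card_pair h.ne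
  have h0 := pivotCol_mem (v := {a, b}) (i := 0) (by omega)
  have h1 := pivotCol_mem (v := {a, b}) (i := 1) (by omega)
  have h2 := pivotCol_lt_of_lt (v := {a, b}) (i := 0) (j := 1) (by omega) (by omega)
  simp only [Finset.mem_insert, Finset.mem_singleton] at h0 h1
  omega

theorem pivotCol_range {k i : ℕ} (h : i < k) : pivotCol (Finset.range k) i = i := by
  refine pivotCol_eq (Finset.mem_range.2 h) ?_
  rw [Nat.count_iff_forall]
  intro a ha
  exact Finset.mem_range.2 (ha.trans h)

theorem concatVec_empty (len : ℕ) (x : Finset ℕ) : concatVec len x ∅ = x := by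
  simp [concatVec]

end Concat

section VZero

variable {w : ℕ → ℕ → ℕ} {k : ℕ}

theorem vZero_zero (w : ℕ → ℕ → ℕ) (k : ℕ) : vZero w k 0 = Finset.range k := by
  cases k <;> rfl

theorem singleton_subset_range_of_lt (hk : 3 ≤ k) {j : ℕ} (hj : j + 1 + 3 ≤ k + 1)
    (hw : ∀ r ∈ Finset.Icc 4 (k + 1), ∀ j ∈ Finset.Icc 1 (r - 3), w r j < r - 3) :
    {3 + w (k + 1) (j + 1)} ⊆ Finset.range (k + 1) := by
  have := hw (k + 1) (by simp; omega) (j + 1) (by simp; omega)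
  rw [Finset.singleton_subset_iff, Finset.mem_range]
  omega

theorem card_vZero {j : ℕ} (hj : j + 3 ≤ k)
    (hw : ∀ r ∈ Finset.Icc 4 k, ∀ j ∈ Finset.Icc 1 (r - 3), w r j < r - 3) :
    (vZero w k j).card = k := by
  induction j generalizing k with
  | zero => rw [vZero_zero, Finset.card_range]
  | succ j ih =>
    obtain ⟨k, rfl⟩ : ∃ k', k = k' + 1 := ⟨k - 1, by omega⟩
    rw [vZero, card_concatVec (singleton_subset_range_of_lt (by omega) hj hw),
      Finset.card_singleton,
      ih (by omega) fun r hr => hw r (Finset.Icc_subset_Icc_right (by omega) hr)]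
    omega

theorem vZero_subset {j : ℕ} (hj : j + 3 ≤ k)
    (hw : ∀ r ∈ Finset.Icc 4 k, ∀ j ∈ Finset.Icc 1 (r - 3), w r j < r - 3) :
    vZero w k j ⊆ Finset.range (∑ i ∈ Finset.Icc (k - j) k, i) := by
  induction j generalizing k with
  | zero => simp [vZero_zero]
  | succ j ih =>
    obtain ⟨k, rfl⟩ : ∃ k', k = k' + 1 := ⟨k - 1, by omega⟩
    rw [vZero, Finset.sum_Icc_succ_top (by omega), Nat.add_sub_add_right, add_comm (∑ i ∈ _, i)]
    exact concatVec_subset (singleton_subset_range_of_lt (by omega) hj hw)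
      (ih (by omega) fun r hr => hw r (Finset.Icc_subset_Icc_right (by omega) hr))

theorem pivotCol_vZero {j : ℕ} (hj : j + 3 ≤ k)
    (hw : ∀ r ∈ Finset.Icc 4 k, ∀ j ∈ Finset.Icc 1 (r - 3), w r j < r - 3)
    {r : ℕ} (hr : j + r < k) :
    pivotCol (vZero w k j) (j + r) + (k - j) = ∑ i ∈ Finset.Icc (k - j) k, i + r := by
  induction j generalizing k with
  | zero => simp [vZero_zero, pivotCol_range (show r < k by omega)]; omega
  | succ j ih =>
    obtain ⟨k, rfl⟩ : ∃ k', k = k' + 1 := ⟨k - 1, by omega⟩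
    have hw' : ∀ r ∈ Finset.Icc 4 k, ∀ j ∈ Finset.Icc 1 (r - 3), w r j < r - 3 :=
      fun r hr => hw r (Finset.Icc_subset_Icc_right (by omega) hr)
    have h1 := pivotCol_concatVec_add (y := vZero w k j) (i := j + r)
      (singleton_subset_range_of_lt (by omega) hj hw)
      (by rw [card_vZero (by omega) hw']; omega)
    rw [Finset.card_singleton, show 1 + (j + r) = j + 1 + r by omega] at h1
    rw [vZero, h1, Finset.sum_Icc_succ_top (by omega), Nat.add_sub_add_right]
    have := ih (by omega) hw' (by omega)
    omega

theorem card_vZero_inter_vZero {j j' : ℕ} (hjj : j < j') (hj : j' + 3 ≤ k)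
    (hw : ∀ r ∈ Finset.Icc 4 k, ∀ j ∈ Finset.Icc 1 (r - 3), w r j < r - 3)
    (hinj : ∀ r ∈ Finset.Icc 4 k, Set.InjOn (w r) (Finset.Icc 1 (r - 3) : Finset ℕ)) :
    (vZero w k j ∩ vZero w k j').card ≤ 1 := by
  induction j' generalizing k j with
  | zero => omega
  | succ j' ih =>
    obtain ⟨k, rfl⟩ : ∃ k', k = k' + 1 := ⟨k - 1, by omega⟩
    have hs := singleton_subset_range_of_lt (by omega) hj hw
    rcases j with _ | j
    · rw [vZero_zero, vZero, ← concatVec_empty (k + 1) (Finset.range (k + 1)),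
        concatVec_inter (Finset.Subset.refl _) hs, Finset.empty_inter, concatVec_empty]
      exact (Finset.card_le_card Finset.inter_subset_right).trans (by simp)
    · have hs' := singleton_subset_range_of_lt (j := j) (by omega) (by omega) hw
      have hne : w (k + 1) (j + 1) ≠ w (k + 1) (j' + 1) := fun e => by
        have := hinj (k + 1) (by simp; omega) (by simp; omega) (by simp; omega) e
        omega
      rw [vZero, vZero, concatVec_inter hs' hs,
        Finset.singleton_inter_of_notMem (by simpa using hne), card_concatVec (by simp),
        Finset.card_empty, zero_add]
      exact ih (by omega) (by omega)
        (fun r hr => hw r (Finset.Icc_subset_Icc_right (by omega) hr))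
        (fun r hr => hinj r (Finset.Icc_subset_Icc_right (by omega) hr))

end VZero

section VSuffix

variable {k i : ℕ}

theorem sA_two : sA 2 = 0 := rfl

theorem sA_succ (hk : 2 ≤ k) : sA (k + 1) = sA k + (k + 1) :=
  Finset.sum_Icc_succ_top (by omega) _

theorem vSuffix_two (i : ℕ) (y : Finset ℕ) : vSuffix i 2 y = y := by
  rw [vSuffix]; simp

theorem vSuffix_succ (i : ℕ) (hk : 2 ≤ k) (y : Finset ℕ) :
    vSuffix i (k + 1) y = concatVec (k + 1) {3 - i} (vSuffix i k y) := by
  obtain ⟨k, rfl⟩ : ∃ k', k = k' + 2 := ⟨k - 2, by omega⟩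
  rw [vSuffix]

theorem singleton_three_sub_subset (hk : 2 ≤ k) (hi : 1 ≤ i) :
    ({3 - i} : Finset ℕ) ⊆ Finset.range (k + 1) := by
  rw [Finset.singleton_subset_iff, Finset.mem_range]
  omega

/-- The vectors of the sets `𝒜_i^k` are the concatenations of a common prefix of length `s` with
the suffixes. -/
theorem vSuffix_eq_concatVec (hk : 2 ≤ k) (i : ℕ) (y : Finset ℕ) :
    vSuffix i k y = concatVec (sA k) (vSuffix i k ∅) y := by
  induction k, hk using Nat.le_induction with
  | base => ext c; simp [vSuffix_two, sA_two, mem_concatVec]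
  | succ k hk ih =>
    rw [vSuffix_succ i hk, vSuffix_succ i hk, ih, concatVec_assoc, sA_succ hk,
      add_comm (sA k)]

theorem vSuffix_empty_subset (hk : 2 ≤ k) (hi : 1 ≤ i) :
    vSuffix i k ∅ ⊆ Finset.range (sA k) := by
  induction k, hk using Nat.le_induction with
  | base => simp [vSuffix_two]
  | succ k hk ih =>
    rw [vSuffix_succ i hk, sA_succ hk, add_comm (sA k)]
    exact concatVec_subset (singleton_three_sub_subset hk hi) ih

theorem card_vSuffix_empty (hk : 2 ≤ k) (hi : 1 ≤ i) : (vSuffix i k ∅).card = k - 2 := by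
  induction k, hk using Nat.le_induction with
  | base => simp [vSuffix_two]
  | succ k hk ih =>
    rw [vSuffix_succ i hk, card_concatVec (singleton_three_sub_subset hk hi), ih,
      Finset.card_singleton]
    omega

theorem card_vSuffix (hk : 2 ≤ k) (hi : 1 ≤ i) {y : Finset ℕ} (hy : y.card = 2) :
    (vSuffix i k y).card = k := by
  rw [vSuffix_eq_concatVec hk, card_concatVec (vSuffix_empty_subset hk hi),
    card_vSuffix_empty hk hi, hy]
  omega

theorem vSuffix_subset (hk : 2 ≤ k) (hi : 1 ≤ i) {m : ℕ} {y : Finset ℕ}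
    (hy : y ⊆ Finset.range m) : vSuffix i k y ⊆ Finset.range (sA k + m) := by
  rw [vSuffix_eq_concatVec hk]
  exact concatVec_subset (vSuffix_empty_subset hk hi) hy

theorem pivotCol_vSuffix_add (hk : 2 ≤ k) (hi : 1 ≤ i) {y : Finset ℕ} {r : ℕ} (hr : r < y.card) :
    pivotCol (vSuffix i k y) (k - 2 + r) = sA k + pivotCol y r := by
  rw [vSuffix_eq_concatVec hk, ← card_vSuffix_empty hk hi,
    pivotCol_concatVec_add (vSuffix_empty_subset hk hi) hr]

theorem rowLen_succ_succ (k r : ℕ) : rowLen (k + 1) (r + 1) = rowLen k r := by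
  rw [rowLen, rowLen]; congr 2; omega

theorem rowLen_zero (k : ℕ) : rowLen (k + 1) 0 = sA k := rfl

theorem pivotCol_vSuffix (hk : 2 ≤ k) (hi : 1 ≤ i) (y : Finset ℕ) {r : ℕ} (hr : r < k - 2) :
    pivotCol (vSuffix i k y) r + rowLen k r + (k - r) = sA k + (3 - i) := by
  induction k, hk using Nat.le_induction generalizing r with
  | base => omega
  | succ k hk ih =>
    rw [vSuffix_succ i hk, sA_succ hk]
    have hs := singleton_three_sub_subset hk hi
    rcases r with _ | r
    · rw [pivotCol_concatVec_of_lt hs (by simp), pivotCol_singleton, rowLen_zero]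
      omega
    · have h1 := pivotCol_concatVec_add (y := vSuffix i k y) (i := r) hs (by
        rw [vSuffix_eq_concatVec hk, card_concatVec (vSuffix_empty_subset hk hi),
          card_vSuffix_empty hk hi]
        omega)
      rw [Finset.card_singleton, add_comm 1 r] at h1
      rw [h1, rowLen_succ_succ]
      have := ih (r := r) (by omega)
      omega

theorem vSuffix_empty_inter (hk : 2 ≤ k) {i' : ℕ} (hi : i ∈ Finset.Icc 1 3)
    (hi' : i' ∈ Finset.Icc 1 3) (hne : i ≠ i') : vSuffix i k ∅ ∩ vSuffix i' k ∅ = ∅ := by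
  rw [Finset.mem_Icc] at hi hi'
  induction k, hk using Nat.le_induction with
  | base => simp [vSuffix_two]
  | succ k hk ih =>
    rw [vSuffix_succ i hk, vSuffix_succ i' hk,
      concatVec_inter (singleton_three_sub_subset hk hi.1) (singleton_three_sub_subset hk hi'.1),
      ih, concatVec_empty, Finset.singleton_inter_of_notMem]
    rw [Finset.mem_singleton]
    omega

theorem card_vZero_inter_vSuffix {w : ℕ → ℕ → ℕ} {j : ℕ} (hj : j + 3 ≤ k)
    (hw : ∀ r ∈ Finset.Icc 4 k, ∀ j ∈ Finset.Icc 1 (r - 3), w r j < r - 3) (hi : 1 ≤ i)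
    (y : Finset ℕ) : (vZero w k j ∩ vSuffix i k y).card ≤ 1 := by
  induction j generalizing k with
  | zero =>
    obtain ⟨k, rfl⟩ : ∃ k', k = k' + 1 := ⟨k - 1, by omega⟩
    rw [vZero_zero, vSuffix_succ i (by omega), ← concatVec_empty (k + 1) (Finset.range (k + 1)),
      concatVec_inter (Finset.Subset.refl _) (singleton_three_sub_subset (by omega) hi),
      Finset.empty_inter, concatVec_empty]
    exact (Finset.card_le_card Finset.inter_subset_right).trans (by simp)
  | succ j ih =>
    obtain ⟨k, rfl⟩ : ∃ k', k = k' + 1 := ⟨k - 1, by omega⟩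
    rw [vZero, vSuffix_succ i (by omega),
      concatVec_inter (singleton_subset_range_of_lt (by omega) hj hw)
        (singleton_three_sub_subset (by omega) hi),
      Finset.singleton_inter_of_notMem (by rw [Finset.mem_singleton]; omega),
      card_concatVec (by simp), Finset.card_empty, zero_add]
    exact ih (by omega) fun r hr => hw r (Finset.Icc_subset_Icc_right (by omega) hr)

end VSuffix

/-! ### Existence and dimension of the codes -/

theorem card_filter_le_val (L a : ℕ) :
    (Finset.univ.filter fun c : Fin L => a ≤ (c : ℕ)).card = L - a := by
  rw [← Finset.card_map Fin.valEmbedding, ← Nat.card_Ico]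
  congr 1
  ext x
  simp only [Finset.mem_map, Finset.mem_filter, Finset.mem_univ, true_and, Fin.valEmbedding_apply,
    Finset.mem_Ico]
  constructor
  · rintro ⟨c, h, rfl⟩
    exact ⟨h, c.2⟩
  · rintro ⟨h1, h2⟩
    exact ⟨⟨x, h2⟩, h1, rfl⟩

theorem dotsOutside_last_two {k L a b : ℕ} (hk : 2 ≤ k) (D : Finset (Fin k × Fin L))
    (h : ∀ r c, (r, c) ∈ D → k - 2 ≤ (r : ℕ) → (r : ℕ) = k - 2 ∧ a ≤ (c : ℕ) ∨
      (r : ℕ) = k - 1 ∧ b ≤ (c : ℕ))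
    (ha : ∀ (r : Fin k) (c : Fin L), (r : ℕ) = k - 2 → a ≤ (c : ℕ) → (r, c) ∈ D)
    (hb : ∀ (r : Fin k) (c : Fin L), (r : ℕ) = k - 1 → b ≤ (c : ℕ) → (r, c) ∈ D) :
    dotsOutside D (k - 1) (k - 2) = (L - a) + (L - b) := by
  rw [dotsOutside, ← card_filter_le_val L a, ← card_filter_le_val L b,
    ← Finset.card_map (Function.Embedding.sectR (⟨k - 2, by omega⟩ : Fin k) (Fin L)),
    ← Finset.card_map (Function.Embedding.sectR (⟨k - 1, by omega⟩ : Fin k) (Fin L)),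
    ← Finset.card_union_of_disjoint]
  · congr 1
    ext ⟨r, c⟩
    simp only [Finset.mem_filter, Finset.mem_union, Finset.mem_map, Finset.mem_univ, true_and,
      Function.Embedding.sectR_apply, Prod.mk.injEq]
    constructor
    · rintro ⟨h1, h2, -⟩
      rcases h r c h1 h2 with ⟨h3, h4⟩ | ⟨h3, h4⟩
      · exact Or.inl ⟨c, h4, Fin.ext h3.symm, rfl⟩
      · exact Or.inr ⟨c, h4, Fin.ext h3.symm, rfl⟩
    · have := c.2
      rintro (⟨c, h1, rfl, rfl⟩ | ⟨c, h1, rfl, rfl⟩)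
      · exact ⟨ha _ _ rfl h1, le_rfl, by omega⟩
      · exact ⟨hb _ _ rfl h1, by simp only; omega, by omega⟩
  · rw [Finset.disjoint_left]
    intro p hp hp'
    obtain ⟨c, -, rfl⟩ := Finset.mem_map.1 hp
    obtain ⟨c', -, h'⟩ := Finset.mem_map.1 hp'
    simp only [Function.Embedding.sectR_apply, Prod.mk.injEq, Fin.mk.injEq] at h'
    omega

theorem sum_Icc_sub_le_sA {k j : ℕ} (hj : j + 3 ≤ k) : ∑ i ∈ Finset.Icc (k - j) k, i ≤ sA k :=
  Finset.sum_le_sum_of_subset (Finset.Icc_subset_Icc_left (by omega))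

theorem le_sum_Icc_sub (k j : ℕ) : k ≤ ∑ i ∈ Finset.Icc (k - j) k, i :=
  Finset.single_le_sum (f := fun i => i) (fun _ _ => Nat.zero_le _)
    (Finset.mem_Icc.2 ⟨by omega, le_rfl⟩)

theorem le_sA {k : ℕ} (hk : 3 ≤ k) : k ≤ sA k :=
  Finset.single_le_sum (f := fun i => i) (fun _ _ => Nat.zero_le _)
    (Finset.mem_Icc.2 ⟨hk, le_rfl⟩)

/-- In the diagram of `v_{0j}^k` the last two rows consist of the last `n - ∑_{i = k - j}^k i`
columns, which are full. -/
theorem isFDMRD_vZero (F : Type*) [Field F] [Fintype F] {k n j : ℕ} (hk : 3 ≤ k)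
    (hn : sA k + k + 2 ≤ n) {w : ℕ → ℕ → ℕ} (hj : j + 3 ≤ k)
    (hw : ∀ r ∈ Finset.Icc 4 k, ∀ j ∈ Finset.Icc 1 (r - 3), w r j < r - 3) :
    (∃ C : Submodule F (Matrix (Fin k) (Fin (n - k)) F),
      IsFDMRD (ferrersDiagram k n (vZero w k j)) (k - 1) C) ∧
      ferrersBound (ferrersDiagram k n (vZero w k j)) (k - 1) =
        2 * (n - ∑ i ∈ Finset.Icc (k - j) k, i) := by
  have hc := card_vZero hj hw
  have hS := sum_Icc_sub_le_sA hj
  have hS' := le_sum_Icc_sub k j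
  have hpiv : ∀ r, j ≤ r → r < k →
      pivotCol (vZero w k j) r + k = ∑ i ∈ Finset.Icc (k - j) k, i + r := fun r h1 h2 => by
    have := pivotCol_vZero (r := r - j) hj hw (by omega)
    rw [show j + (r - j) = r by omega] at this
    omega
  set S := ∑ i ∈ Finset.Icc (k - j) k, i
  set v := vZero w k j
  have e1 := hpiv (k - 2) (by omega) (by omega)
  obtain ⟨h1, h2⟩ := exists_isFDMRD F (k := k) (N := n - S) (L := n - k) (by omega) (by omega)
    (by omega) (ferrersDiagram k n v) (fun p hp hp2 => by
      rw [mem_ferrersDiagram hc]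
      have e2 := pivotCol_add_le (v := v) p.1 (k - 2 - p.1) (by omega)
      rw [show (p.1 : ℕ) + (k - 2 - p.1) = k - 2 by omega] at e2
      omega) (fun p hp hp2 => by
      rw [mem_ferrersDiagram hc] at hp
      have := hpiv p.1 (by omega) p.1.2
      omega)
  refine ⟨h1, h2.trans ?_⟩
  rw [dotsOutside_last_two (a := S - k) (b := S - k) (by omega)]
  · omega
  · intro r c hrc hr
    rw [mem_ferrersDiagram hc] at hrc
    have := hpiv r (by omega) r.2
    simp only at hrc
    omega
  all_goals
    intro r c hr hrc
    rw [mem_ferrersDiagram hc]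
    have := hpiv r (by omega) r.2
    simp only
    omega

theorem exists_pair_of_mem_powersetCard {m : ℕ} {y : Finset ℕ}
    (hy : y ∈ (Finset.range m).powersetCard 2) : ∃ a b, a < b ∧ b < m ∧ y = {a, b} := by
  rw [Finset.mem_powersetCard] at hy
  obtain ⟨a, b, hne, rfl⟩ := Finset.card_eq_two.1 hy.2
  have ha := Finset.mem_range.1 (hy.1 (Finset.mem_insert_self a _))
  have hb := Finset.mem_range.1 (hy.1 (Finset.mem_insert_of_mem (Finset.mem_singleton_self b)))
  rcases hne.lt_or_gt with h | h
  · exact ⟨a, b, h, hb, rfl⟩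
  · exact ⟨b, a, h, ha, Finset.pair_comm a b⟩

theorem mem_lastDots {k n : ℕ} {v : Finset ℕ} (hc : v.card = k) (p : Fin k × Fin (n - k)) :
    p ∈ lastDots k n v ↔
      pivotCol v p.1 ≤ p.1 + p.2 ∧ n - k ≤ (p.2 : ℕ) + (n - sA k - 2) := by
  rw [lastDots, Finset.mem_filter, mem_ferrersDiagram hc]

/-- For the suffix `y = {a, b}` with `a < b`, the last two rows of the diagram have `n - s - 2 - a` and
`n - s - 1 - b` dots. -/
theorem isFDMRD_vSuffix (F : Type*) [Field F] [Fintype F] {k n i : ℕ} (hk : 3 ≤ k)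
    (hn : sA k + k + 2 ≤ n) (hi : 1 ≤ i) {y : Finset ℕ}
    (hy : y ∈ (Finset.range (n - sA k)).powersetCard 2) :
    (∃ C : Submodule F (Matrix (Fin k) (Fin (n - k)) F),
      IsFDMRD (lastDots k n (vSuffix i k y)) (k - 1) C) ∧
      ferrersBound (lastDots k n (vSuffix i k y)) (k - 1) = 2 * (n - sA k) - 3 - ∑ c ∈ y, c := by
  have hc := card_vSuffix (k := k) (i := i) (by omega) hi (Finset.mem_powersetCard.1 hy).2
  have hy2 := (Finset.mem_powersetCard.1 hy).2
  obtain ⟨a, b, hab, hb, rfl⟩ := exists_pair_of_mem_powersetCard hy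
  have hs := le_sA hk
  obtain ⟨ha, hb'⟩ := pivotCol_pair hab
  have e1 := pivotCol_vSuffix_add (k := k) (i := i) (y := {a, b}) (r := 0) (by omega) hi (by omega)
  have e2 := pivotCol_vSuffix_add (k := k) (i := i) (y := {a, b}) (r := 1) (by omega) hi (by omega)
  rw [ha, add_zero] at e1
  rw [hb', show k - 2 + 1 = k - 1 by omega] at e2
  rw [Finset.sum_pair hab.ne]
  have hlast : ∀ r : Fin k, k - 2 ≤ (r : ℕ) → (r : ℕ) = k - 2 ∨ (r : ℕ) = k - 1 :=
    fun r h => by omega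
  obtain ⟨h1, h2⟩ := exists_isFDMRD F (k := k) (N := n - sA k - 2) (L := n - k) (by omega)
    (by omega) (by omega) (lastDots k n (vSuffix i k {a, b})) (fun p hp hp2 => by
      rw [mem_lastDots hc]
      have := pivotCol_vSuffix (k := k) (by omega) hi {a, b} hp
      omega) (fun p hp _ => ((mem_lastDots hc p).1 hp).2)
  refine ⟨h1, h2.trans ?_⟩
  rw [dotsOutside_last_two (a := sA k + 2 + a - k) (b := sA k + 1 + b - k) (by omega)]
  · omega
  · intro r c hrc hr
    rw [mem_lastDots hc] at hrc
    simp only at hrc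
    rcases hlast r hr with h | h
    · rw [h, e1] at hrc; omega
    · rw [h, e2] at hrc; omega
  · intro r c hr hrc
    rw [mem_lastDots hc]
    simp only [hr, e1]
    omega
  · intro r c hr hrc
    rw [mem_lastDots hc]
    simp only [hr, e2]
    omega

theorem three_mul_le_rowLen (k r : ℕ) : 3 * (k - 3 - r) ≤ rowLen k r := by
  have h : (Finset.Icc 3 (k - (r + 1))).card • 3 ≤ ∑ i ∈ Finset.Icc 3 (k - (r + 1)), i :=
    Finset.card_nsmul_le_sum _ _ _ fun i hi => (Finset.mem_Icc.1 hi).1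
  rw [Nat.card_Icc, smul_eq_mul] at h
  rw [rowLen]
  omega

theorem rowLen_eq_zero {k r : ℕ} (h : k ≤ r + 3) : rowLen k r = 0 := by
  rw [rowLen, Finset.Icc_eq_empty (by omega), Finset.sum_empty]

theorem rowLen_le {k : ℕ} (hk : 3 ≤ k) (r : ℕ) : rowLen k r + 2 ≤ sA k + 2 - k := by
  obtain ⟨k, rfl⟩ : ∃ k', k = k' + 1 := ⟨k - 1, by omega⟩
  rw [sA_succ (by omega)]
  have : rowLen (k + 1) r ≤ sA k :=
    Finset.sum_le_sum_of_subset (Finset.Icc_subset_Icc_right (by omega))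
  omega

/-- The FDMRD codes for the pending blocks are three-dimensional: only the three dots in the last
nonempty row count for the upper bound. A code which attains it repeats a vector of length three
in each row, in disjoint triples of columns. -/
theorem exists_isFDMRD_blockDiagram (F : Type*) [Field F] {k : ℕ} (hk : 4 ≤ k) :
    ∃ C : Submodule F (Matrix (Fin k) (Fin (sA k + 2 - k)) F),
      IsFDMRD (blockDiagram k) (k - 3) C ∧ Module.finrank F C = 3 := by
  set W := sA k + 2 - k with hW
  have hWle : ∀ r, 3 * (k - 3 - r) + 2 ≤ W := fun r => by
    have := three_mul_le_rowLen k r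
    have := rowLen_le (k := k) (by omega) r
    omega
  let f : (Fin 3 → F) →ₗ[F] Matrix (Fin k) (Fin W) F :=
    { toFun := fun x => Matrix.of fun r c =>
        if h : (r : ℕ) < k - 3 ∧ W ≤ c + 3 * (k - 3 - r) ∧ c + 3 * (k - 3 - r) < W + 3 then
          x ⟨c + 3 * (k - 3 - r) - W, by omega⟩ else 0
      map_add' := fun x y => by
        ext r c
        simp only [Matrix.add_apply, Matrix.of_apply]
        split_ifs <;> simp
      map_smul' := fun a x => by
        ext r c
        simp only [Matrix.smul_apply, Matrix.of_apply, RingHom.id_apply]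
        split_ifs <;> simp }
  have hf : ∀ x r c, f x r c =
      if h : (r : ℕ) < k - 3 ∧ W ≤ c + 3 * (k - 3 - r) ∧ c + 3 * (k - 3 - r) < W + 3 then
          x ⟨c + 3 * (k - 3 - r) - W, by omega⟩ else 0 := fun _ _ _ => rfl
  have hrank : ∀ x ≠ 0, k - 3 ≤ (f x).rank := by
    intro x hx
    obtain ⟨e, he⟩ := Function.ne_iff.1 hx
    have h1 := finrank_ker_vecMulLinear_add_rank (f x)
    have h2 : Module.finrank F (LinearMap.ker (f x).vecMulLinear) ≤ (Finset.Ico (k - 3) k).card := by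
      refine finrank_le_card_of_forall_eq_zero _ _ fun c hc h0 => funext fun r => ?_
      by_cases hr : (r : ℕ) < k - 3
      · have hWr := hWle r
        have h3 := congrFun (LinearMap.mem_ker.1 hc)
          ⟨W - 3 * (k - 3 - r) + e, by have := e.2; omega⟩
        rw [Matrix.vecMulLinear_apply, Matrix.vecMul, dotProduct, Finset.sum_eq_single r] at h3
        · rw [hf, dif_pos (by simp only; omega)] at h3
          have h4 : (⟨W - 3 * (k - 3 - r) + e + 3 * (k - 3 - r) - W, by omega⟩ : Fin 3) = e :=
            Fin.ext (by simp only; omega)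
          simp only [h4] at h3
          exact (mul_eq_zero.1 h3).resolve_right he
        · intro r' _ hne
          have : (r' : ℕ) ≠ r := fun h => hne (Fin.ext h)
          have := hWle r'
          rw [hf, dif_neg (by simp only; omega), mul_zero]
        · exact fun h => absurd (Finset.mem_univ _) h
      · exact h0 r (Finset.mem_Ico.2 ⟨by omega, r.2⟩)
    rw [Nat.card_Ico] at h2
    omega
  have hinj : Function.Injective f := by
    rw [← LinearMap.ker_eq_bot, LinearMap.ker_eq_bot']
    intro x hx
    by_contra hne
    have := hrank x hne
    rw [hx, Matrix.rank_zero] at this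
    omega
  have hdim : Module.finrank F (LinearMap.range f) = 3 := by
    rw [LinearMap.finrank_range_of_inj hinj]; simp
  refine ⟨LinearMap.range f, (isFDMRD_of_dotsOutside_le (by omega) ?_ ?_ ?_).1, hdim⟩
  · rintro _ ⟨x, rfl⟩ r c hrc
    have := three_mul_le_rowLen k r
    rw [blockDiagram, Finset.mem_filter] at hrc
    simp only [Finset.mem_univ, true_and, ← hW] at hrc
    rw [hf, dif_neg (by omega)]
  · rintro _ ⟨x, rfl⟩ hne
    exact hrank x fun h => hne (by rw [h, map_zero])
  · rw [hdim, dotsOutside]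
    have hlast : rowLen k (k - 4) = 3 := by
      rw [rowLen, show k - (k - 4 + 1) = 3 by omega]; rfl
    have hmem : ∀ r : Fin k, ∀ c : Fin W, (r, c) ∈ (blockDiagram k).filter (fun p =>
        k - 3 - 1 ≤ (p.1 : ℕ) ∧ (p.2 : ℕ) + (k - 3 - 1 - (k - 3 - 1)) < sA k + 2 - k) →
        (r : ℕ) = k - 4 ∧ W - 3 ≤ (c : ℕ) := by
      intro r c hp
      rw [blockDiagram, Finset.mem_filter, Finset.mem_filter] at hp
      obtain ⟨⟨-, h1⟩, h2, -⟩ := hp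
      simp only [← hW] at h1 h2
      have hr : (r : ℕ) = k - 4 := by
        by_contra hne
        rw [rowLen_eq_zero (by omega)] at h1
        omega
      rw [hr, hlast] at h1
      omega
    calc _ ≤ (Finset.Ico (W - 3) W).card := by
          refine Finset.card_le_card_of_injOn (fun p => (p.2 : ℕ)) ?_ ?_
          · rintro ⟨r, c⟩ hp
            have h1 := hmem r c hp
            have h2 := c.2
            rw [Finset.coe_Ico, Set.mem_Ico]
            simp only
            omega
          · rintro ⟨r, c⟩ hp ⟨r', c'⟩ hp' h
            have h1 := hmem r c hp
            have h2 := hmem r' c' hp'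
            exact Prod.ext (Fin.ext (by simp only; omega)) (Fin.ext h)
      _ ≤ 3 := by rw [Nat.card_Ico]; omega

/-! ### The choices of the construction -/

/-- The class of a pair `y` of `m` nodes in the round-robin schedule, for `M = numClasses m`: the
sum of its nodes modulo the odd number `M`, where the additional node `M` of an even `m` counts as
the other node of its pair. -/
def roundRobin (M : ℕ) (y : Finset ℕ) : ℕ :=
  if M ∈ y then (2 * ∑ c ∈ y.erase M, c) % M else (∑ c ∈ y, c) % M

theorem roundRobin_pair {M a b : ℕ} (hab : a ≠ b) (ha : a ≠ M) :
    roundRobin M {a, b} = (a + if b = M then a else b) % M := by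
  by_cases hb : b = M
  · subst hb
    rw [roundRobin, if_pos (by simp), if_pos rfl, Finset.pair_comm,
      Finset.erase_insert (by simpa using hab.symm), Finset.sum_singleton, two_mul]
  · rw [roundRobin, if_neg (by simp [ha.symm, Ne.symm hb]), if_neg hb, Finset.sum_pair hab]

theorem eq_of_add_mod_eq {M a b c : ℕ} (hb : b < M) (hc : c < M)
    (h : (a + b) % M = (a + c) % M) : b = c := by
  have h1 : b ≡ c [MOD M] := Nat.ModEq.add_left_cancel' a h
  exact Nat.ModEq.eq_of_lt_of_lt h1 hb hc

/-- Two distinct pairs in the same class of the round-robin schedule are disjoint. -/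
theorem disjoint_of_roundRobin_eq {m M : ℕ} (hM : Odd M) (hm : m ≤ M + 1) {y y' : Finset ℕ}
    (hy : y ∈ (Finset.range m).powersetCard 2) (hy' : y' ∈ (Finset.range m).powersetCard 2)
    (h : roundRobin M y = roundRobin M y') (hne : y ≠ y') : Disjoint y y' := by
  rw [Finset.disjoint_left]
  intro a ha ha'
  refine hne ?_
  have key : ∀ z ∈ (Finset.range m).powersetCard 2, a ∈ z → ∃ b, b ≠ a ∧ b < m ∧ a < m ∧
      z = {a, b} := by
    intro z hz haz
    obtain ⟨c, d, hcd, hd, rfl⟩ := exists_pair_of_mem_powersetCard hz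
    simp only [Finset.mem_insert, Finset.mem_singleton] at haz
    rcases haz with rfl | rfl
    · exact ⟨d, by omega, hd, by omega, rfl⟩
    · exact ⟨c, by omega, by omega, hd, Finset.pair_comm _ _⟩
  obtain ⟨b, hb, hbm, ham, rfl⟩ := key y hy ha
  obtain ⟨c, hc, hcm, -, rfl⟩ := key y' hy' ha'
  suffices b = c by rw [this]
  by_cases haM : a = M
  · subst haM
    rw [Finset.pair_comm a b, Finset.pair_comm a c, roundRobin_pair hb hb, roundRobin_pair hc hc,
      if_pos rfl, if_pos rfl, ← two_mul, ← two_mul] at h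
    -- the modulus is odd, so that `2` can be cancelled
    have h1 : 2 * b ≡ 2 * c [MOD a] := h
    have h2 := Nat.ModEq.cancel_left_of_coprime (Nat.Coprime.gcd_eq_one
      (Nat.coprime_two_right.2 hM)) h1
    exact Nat.ModEq.eq_of_lt_of_lt h2 (by omega) (by omega)
  · rw [roundRobin_pair hb.symm haM, roundRobin_pair hc.symm haM] at h
    have h1 := eq_of_add_mod_eq (by split_ifs <;> omega) (by split_ifs <;> omega) h
    split_ifs at h1 <;> omega

theorem exists_isOneFactorization {m : ℕ} (hm : 2 ≤ m) : ∃ P, IsOneFactorization m P := by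
  set M := numClasses m with hMdef
  have hodd : Odd M ∧ m ≤ M + 1 ∧ M * (m / 2) = m * (m - 1) / 2 := by
    rw [hMdef, numClasses]
    split_ifs with h
    · obtain ⟨r, rfl⟩ := h
      refine ⟨⟨r - 1, by omega⟩, by omega, ?_⟩
      rw [show (r + r) * (r + r - 1) = 2 * ((r + r - 1) * r) by ring,
        Nat.mul_div_cancel_left _ two_pos]
      congr 1; omega
    · obtain ⟨r, rfl⟩ := Nat.not_even_iff_odd.1 h
      refine ⟨⟨r, rfl⟩, by omega, ?_⟩
      rw [show (2 * r + 1 - 1) = 2 * r by omega,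
        show (2 * r + 1) * (2 * r) = 2 * ((2 * r + 1) * r) by ring,
        Nat.mul_div_cancel_left _ two_pos]
      congr 1; omega
  obtain ⟨hodd, hmM, hmul⟩ := hodd
  have hM0 : 0 < M := hodd.pos
  let P : ℕ → Finset (Finset ℕ) := fun t =>
    ((Finset.range m).powersetCard 2).filter fun y => roundRobin M y + 1 = t
  have hlt : ∀ y, roundRobin M y < M := fun y => by
    rw [roundRobin]; split_ifs <;> exact Nat.mod_lt _ hM0
  have hdisj : ∀ t, ∀ y ∈ P t, ∀ y' ∈ P t, y ≠ y' → Disjoint y y' := by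
    intro t y hy y' hy' hne
    obtain ⟨h1, h2⟩ := Finset.mem_filter.1 hy
    obtain ⟨h1', h2'⟩ := Finset.mem_filter.1 hy'
    exact disjoint_of_roundRobin_eq hodd hmM h1 h1' (by omega) hne
  have hle : ∀ t, (P t).card ≤ m / 2 := by
    intro t
    have h1 : ((P t).biUnion fun y => y).card = (P t).card * 2 := by
      rw [Finset.card_biUnion fun y hy y' hy' hne => hdisj t y hy y' hy' hne]
      exact Finset.sum_const_nat fun y hy =>
        (Finset.mem_powersetCard.1 (Finset.mem_filter.1 hy).1).2
    have h2 : ((P t).biUnion fun y => y).card ≤ (Finset.range m).card :=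
      Finset.card_le_card (Finset.biUnion_subset.2 fun y hy =>
        (Finset.mem_powersetCard.1 (Finset.mem_filter.1 hy).1).1)
    rw [Finset.card_range] at h2
    omega
  -- the sizes of the classes are at most `m / 2` and sum up to `M * (m / 2)`
  have hsum : ∑ t ∈ Finset.Icc 1 M, (P t).card = ∑ t ∈ Finset.Icc 1 M, m / 2 := by
    rw [← Finset.card_eq_sum_card_fiberwise (f := fun y => roundRobin M y + 1)
      (s := (Finset.range m).powersetCard 2) (t := Finset.Icc 1 M)
      fun y _ => by have := hlt y; simp; omega]
    rw [Finset.card_powersetCard, Finset.card_range, Nat.choose_two_right, Finset.sum_const,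
      Nat.card_Icc, Nat.add_sub_cancel, smul_eq_mul, hmul]
  refine ⟨P, fun t _ y hy => (Finset.mem_filter.1 hy).1, fun y hy => ?_, fun t ht => ?_,
    fun t _ => hdisj t⟩
  · refine ⟨roundRobin M y + 1, ⟨?_, Finset.mem_filter.2 ⟨hy, rfl⟩⟩, fun t ht => ?_⟩
    · have := hlt y
      rw [Finset.mem_Icc]; omega
    · exact (Finset.mem_filter.1 ht.2).2.symm
  · exact (Finset.sum_eq_sum_iff_of_le fun t _ => hle t).1 hsum t ht

theorem exists_injOn_range {α : Type*} [Finite α] [Zero α] {N : ℕ} (h : N ≤ Nat.card α) :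
    ∃ e : ℕ → α, Set.InjOn e (Set.Iio N) := by
  let f := (Finite.equivFin α).symm
  refine ⟨fun i => if hi : i < Nat.card α then f ⟨i, hi⟩ else 0, fun i hi j hj hij => ?_⟩
  rw [Set.mem_Iio] at hi hj
  simp only [dif_pos (hi.trans_le h), dif_pos (hj.trans_le h)] at hij
  simpa using hij

/-- There are enough tuples of length at most two for the labels of the classes: `q` for the second
kind, and `q ^ 2` for the third kind, where `t - (q + 2)` is written in base `q`. -/
theorem exists_label (F : Type*) [Field F] [Fintype F] {l : ℕ}
    (hl : l ≤ Fintype.card F ^ 2 + Fintype.card F + 1) :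
    ∃ label : ℕ → ℕ → F, ∀ t ∈ Finset.Icc 1 l, ∀ t' ∈ Finset.Icc 1 l, t ≠ t' →
      classLevel (Fintype.card F) t = classLevel (Fintype.card F) t' →
      ∃ e < classLevel (Fintype.card F) t - 1, label t e ≠ label t' e := by
  set q := Fintype.card F with hq
  have hq0 : 1 < q := Fintype.one_lt_card
  obtain ⟨e, he⟩ := exists_injOn_range (α := F) (N := q) (by rw [Nat.card_eq_fintype_card])
  refine ⟨fun t i => if t ≤ q + 1 then e (t - 2) else
    if i = 0 then e ((t - (q + 2)) / q) else e ((t - (q + 2)) % q), ?_⟩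
  intro t ht t' ht' hne hlev
  rw [Finset.mem_Icc] at ht ht'
  have h1 : classLevel q t = classLevel q t' → (2 ≤ t ∧ t ≤ q + 1 ∧ 2 ≤ t' ∧ t' ≤ q + 1 ∧
      classLevel q t = 2) ∨ (q + 2 ≤ t ∧ q + 2 ≤ t' ∧ classLevel q t = 3) := by
    rw [classLevel, classLevel]
    split_ifs <;> omega
  rcases h1 hlev with ⟨h2, h3, h4, h5, h6⟩ | ⟨h2, h3, h4⟩
  · refine ⟨0, by omega, ?_⟩
    simp only [if_pos h3, if_pos h5]
    intro h
    have := he (Set.mem_Iio.2 (by omega)) (Set.mem_Iio.2 (by omega)) h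
    omega
  · rw [h4]
    by_contra! hcon
    have e0 := hcon 0 (by omega)
    have e1 := hcon 1 (by omega)
    simp only [if_neg (show ¬ t ≤ q + 1 by omega), if_neg (show ¬ t' ≤ q + 1 by omega), if_true,
      if_neg one_ne_zero] at e0 e1
    have hdiv : ∀ u, u ≤ q ^ 2 + q + 1 → (u - (q + 2)) / q < q := fun u hu =>
      Nat.div_lt_of_lt_mul (by rw [← sq]; have : 0 < q ^ 2 := by positivity
                               omega)
    have f0 := he (hdiv t (by omega)) (hdiv t' (by omega)) e0
    have f1 := he (Nat.mod_lt _ (by omega)) (Nat.mod_lt _ (by omega)) e1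
    have g := Nat.div_add_mod (t - (q + 2)) q
    have g' := Nat.div_add_mod (t' - (q + 2)) q
    rw [f0, f1, g'] at g
    omega

theorem classLevel_mem (q t : ℕ) : classLevel q t ∈ Finset.Icc 1 3 := by
  rw [classLevel]; split_ifs <;> decide

theorem nonempty_constructionA (F : Type*) [Field F] [Fintype F] {k n : ℕ} (hk : 4 ≤ k)
    (hn : sA k + k + 2 ≤ n)
    (hq : numClasses (n - sA k) ≤ Fintype.card F ^ 2 + Fintype.card F + 1) :
    Nonempty (ConstructionA F k n) := by
  obtain ⟨P, hP⟩ := exists_isOneFactorization (m := n - sA k) (by omega)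
  obtain ⟨label, hlabel⟩ := exists_label F hq
  obtain ⟨B, hB, hB3⟩ := exists_isFDMRD_blockDiagram F hk
  -- disjoint pairs have distinct minima, and there are at least `n - s` codewords
  obtain ⟨e, he⟩ := exists_injOn_range (α := B) (N := n - sA k) (by
    rw [Module.natCard_eq_pow_finrank (K := F), hB3, Nat.card_eq_fintype_card]
    have hq2 : 2 ≤ Fintype.card F := Fintype.one_lt_card
    rw [numClasses] at hq
    have h1 : n - sA k ≤ Fintype.card F ^ 2 + Fintype.card F + 2 := by
      split_ifs at hq <;> omega
    nlinarith)
  have hw : ∀ r ∈ Finset.Icc 4 k, ∀ j ∈ Finset.Icc 1 (r - 3), j - 1 < r - 3 := by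
    intro r hr j hj
    rw [Finset.mem_Icc] at hr hj
    omega
  have hz := fun j (hj : j ∈ Finset.range (k - 2)) =>
    (isFDMRD_vZero F (by omega) hn (w := fun _ j => j - 1) (j := j)
      (by have := Finset.mem_range.1 hj; omega) hw).1
  have hs := fun t (ht : t ∈ Finset.Icc 1 (numClasses (n - sA k))) y (hy : y ∈ P t) =>
    (isFDMRD_vSuffix F (i := classLevel (Fintype.card F) t) (by omega) hn
      (Finset.mem_Icc.1 (classLevel_mem _ _)).1 (hP.mem t ht y hy)).1
  choose! Z hZ using hz
  choose! S hS using hs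
  have hmin : ∀ t ∈ Finset.Icc 1 (numClasses (n - sA k)), ∀ y ∈ P t,
      sInf (y : Set ℕ) ∈ y := fun t ht y hy => by
    refine Nat.sInf_mem (s := (y : Set ℕ)) ?_
    rw [Finset.coe_nonempty, ← Finset.card_pos, (Finset.mem_powersetCard.1 (hP.mem t ht y hy)).2]
    exact two_pos
  refine ⟨{
    P := P
    isOneFactorization := hP
    w := fun _ j => j - 1
    w_lt := hw
    w_inj := fun r hr j hj j' hj' h => ?_
    codeZero := Z
    codeZero_isFDMRD := hZ
    label := label
    label_ne := hlabel
    blockCode := fun _ => B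
    blockCode_isFDMRD := fun _ _ => hB
    block := fun y => e (sInf (y : Set ℕ))
    block_mem := fun _ _ y _ => (e _).2
    block_inj := fun t ht y hy y' hy' h => ?_
    codeSuffix := fun y => S (Classical.epsilon fun t =>
      t ∈ Finset.Icc 1 (numClasses (n - sA k)) ∧ y ∈ P t) y
    codeSuffix_isFDMRD := fun t ht y hy => ?_ }⟩
  · simp only [Finset.coe_Icc, Set.mem_Icc] at hj hj'
    simp only at h
    omega
  · have h1 := hmin t ht y hy
    have h2 := hmin t ht y' hy'
    have hlt := fun {y c} hy (hc : c ∈ y) =>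
      Finset.mem_range.1 ((Finset.mem_powersetCard.1 (hP.mem t ht y hy)).1 hc)
    have h3 := he (hlt hy h1) (hlt hy' h2) (Subtype.ext h)
    by_contra hne
    exact Finset.disjoint_left.1 (hP.disjoint t ht y hy y' hy' hne) h1 (h3 ▸ h2)
  · have hex : ∃ t, t ∈ Finset.Icc 1 (numClasses (n - sA k)) ∧ y ∈ P t := ⟨t, ht, hy⟩
    have h1 := Classical.epsilon_spec hex
    have h2 := (hP.existsUnique y (hP.mem t ht y hy)).unique h1 ⟨ht, hy⟩
    rw [h2]
    exact hS t ht y hy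

/-! ### Pending blocks -/

section Pending

variable {F : Type*} [Field F] {k n i : ℕ}

/-- The pending block is confined to its dots: row `r` has its rightmost `rowLen k r + (i - 1)`
entries among the first `s + 2 - k` columns. -/
theorem pendingFill_eq_zero {a : ℕ → F} {B : Matrix (Fin k) (Fin (sA k + 2 - k)) F}
    (hB : ∀ r c, (r, c) ∉ blockDiagram k → B r c = 0) {r : Fin k} {c : Fin (n - k)}
    (h : k - 2 ≤ (r : ℕ) ∨ sA k + 2 - k ≤ (c : ℕ) ∨
      (c : ℕ) + rowLen k r + (i - 1) < sA k + 2 - k) :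
    pendingFill k n i a B r c = 0 := by
  rw [pendingFill]
  split_ifs with h1 h2
  · omega
  · refine hB _ _ fun hmem => ?_
    simp only [blockDiagram, Finset.mem_filter, Finset.mem_univ, true_and] at hmem
    rcases h with h | h | h
    · rw [rowLen_eq_zero (by omega)] at hmem
      omega
    · omega
    · omega
  · rfl

theorem pendingFill_sub_pendingFill {a : ℕ → F}
    {B B' : Matrix (Fin k) (Fin (sA k + 2 - k)) F}
    (hB : ∀ r c, (r, c) ∉ blockDiagram k → B r c = 0)
    (hB' : ∀ r c, (r, c) ∉ blockDiagram k → B' r c = 0) (r : Fin k) (c : Fin (n - k))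
    (hc : (c : ℕ) < sA k + 2 - k) :
    pendingFill k n i a B r c - pendingFill k n i a B' r c = (B - B') r ⟨c, hc⟩ := by
  rw [pendingFill, pendingFill, dif_pos hc, dif_pos hc]
  split_ifs with h
  · have hnot : (r, (⟨c, hc⟩ : Fin (sA k + 2 - k))) ∉ blockDiagram k := by
      simp only [blockDiagram, Finset.mem_filter, Finset.mem_univ, true_and]
      omega
    rw [Matrix.sub_apply, hB _ _ hnot, hB' _ _ hnot, sub_self, sub_self]
  · rfl

theorem pendingFill_label {a : ℕ → F} {B : Matrix (Fin k) (Fin (sA k + 2 - k)) F} {r : Fin k}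
    {c : Fin (n - k)} {e : ℕ} (hr : (r : ℕ) < k - 2) (he : e < i - 1)
    (hc : (c : ℕ) + rowLen k r + (i - 1) = sA k + 2 - k + e) :
    pendingFill k n i a B r c = a e := by
  rw [pendingFill, dif_pos (by omega), if_pos (by omega)]
  congr 1
  omega

theorem rowLen_add_three_le {r r' : ℕ} (h : r < r') (hr' : r' < k - 2) :
    rowLen k r' + 3 ≤ rowLen k r := by
  have h1 : rowLen k r = rowLen k (r + 1) + (k - (r + 1)) := by
    rw [rowLen, rowLen, show k - (r + 1) = k - (r + 1 + 1) + 1 by omega,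
      Finset.sum_Icc_succ_top (by omega)]
  have h2 : rowLen k r' ≤ rowLen k (r + 1) :=
    Finset.sum_le_sum_of_subset (Finset.Icc_subset_Icc_right (by omega))
  omega

/-- If the tuples of two pending blocks differ, then the rows of the difference of the two blocks
are linearly independent: the rows of the block get shorter by at least three dots from each row to
the next, so that the first different entries in the rows form a staircase. -/
theorem eq_zero_of_sum_mul_pendingFill_sub_eq_zero (hk : 3 ≤ k) (hn : sA k + 2 ≤ n) (hi : i ≤ 3)
    {a a' : ℕ → F} {B B' : Matrix (Fin k) (Fin (sA k + 2 - k)) F}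
    (hB : ∀ r c, (r, c) ∉ blockDiagram k → B r c = 0)
    (hB' : ∀ r c, (r, c) ∉ blockDiagram k → B' r c = 0)
    {e : ℕ} (he : e < i - 1) (hne : a e ≠ a' e) (g : Fin k → F)
    (hg : ∀ c : Fin (n - k), (c : ℕ) < sA k + 2 - k →
      ∑ r, g r * (pendingFill k n i a B r c - pendingFill k n i a' B' r c) = 0)
    (r : Fin k) (hr : (r : ℕ) < k - 2) : g r = 0 := by
  induction r using WellFoundedLT.induction with
  | ind r ih =>
    have h1 := rowLen_le hk r
    -- the column of the `e`-th entry of the tuple in row `r`, which is left of the block in the rows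
    -- below
    let c : Fin (n - k) := ⟨sA k + 2 - k + e - rowLen k r - (i - 1), by omega⟩
    have hc : (c : ℕ) + rowLen k r + (i - 1) = sA k + 2 - k + e := by
      simp only [c]; omega
    have h2 := hg c (by omega)
    rw [Finset.sum_eq_single r, pendingFill_label hr he hc, pendingFill_label hr he hc] at h2
    · exact (mul_eq_zero.1 h2).resolve_right (sub_ne_zero.2 hne)
    · intro r' _ hrr'
      rcases lt_or_gt_of_ne hrr' with h | h
      · rw [ih r' h (by have : (r' : ℕ) < r := h
                        omega), zero_mul]
      · have h' : (r : ℕ) < r' := h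
        have h3 : k - 2 ≤ (r' : ℕ) ∨ sA k + 2 - k ≤ (c : ℕ) ∨
            (c : ℕ) + rowLen k r' + (i - 1) < sA k + 2 - k := by
          by_cases h4 : (r' : ℕ) < k - 2
          · have := rowLen_add_three_le h' h4
            omega
          · exact Or.inl (by omega)
        rw [pendingFill_eq_zero hB h3, pendingFill_eq_zero hB' h3, sub_self, mul_zero]
    · exact fun h => absurd (Finset.mem_univ r) h

/-- If only the first `ρ` rows of a matrix are nonzero and its rank is `ρ`, then these rows are
linearly independent. -/
theorem eq_zero_of_vecMul_eq_zero_of_le_rank {l ρ : ℕ} (hρ : ρ ≤ k)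
    {A : Matrix (Fin k) (Fin l) F} (hA : ∀ (r : Fin k) c, ρ ≤ (r : ℕ) → A r c = 0)
    (hrank : ρ ≤ A.rank)
    {g : Fin k → F} (hg : Matrix.vecMul g A = 0) (r : Fin k) (hr : (r : ℕ) < ρ) : g r = 0 := by
  let A₀ : Matrix (Fin ρ) (Fin l) F := A.submatrix (Fin.castLE hρ) id
  have hA₀ : A = (Matrix.of fun (r : Fin k) (j : Fin ρ) => if (j : ℕ) = r then (1 : F) else 0)
      * A₀ := by
    ext r c
    rw [Matrix.mul_apply]
    by_cases hr : (r : ℕ) < ρ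
    · rw [Finset.sum_eq_single ⟨r, hr⟩]
      · simp [A₀]
      · intro j _ hj
        rw [Matrix.of_apply, if_neg (fun h => hj (Fin.ext h)), zero_mul]
      · exact fun h => absurd (Finset.mem_univ _) h
    · rw [hA r c (by omega)]
      refine (Finset.sum_eq_zero fun j _ => ?_).symm
      rw [Matrix.of_apply, if_neg (by omega), zero_mul]
  have h1 : A.rank ≤ A₀.rank := by
    conv_lhs => rw [hA₀]
    exact Matrix.rank_mul_le_right _ _
  have h2 := finrank_ker_vecMulLinear_add_rank A₀
  have h3 : LinearMap.ker A₀.vecMulLinear = ⊥ := Submodule.finrank_eq_zero.1 (by omega)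
  have h4 : (fun j => g (Fin.castLE hρ j)) ∈ LinearMap.ker A₀.vecMulLinear := by
    rw [LinearMap.mem_ker, Matrix.vecMulLinear_apply]
    funext c
    have h5 := congrFun hg c
    rw [Matrix.vecMul, dotProduct] at h5 ⊢
    rw [← h5]
    refine Finset.sum_of_injOn (Fin.castLE hρ) (Fin.castLE_injective hρ).injOn
      (fun _ _ => Finset.mem_univ _) (fun r _ hr => ?_) (fun _ _ => rfl)
    rw [hA r c, mul_zero]
    by_contra hlt
    exact hr ⟨⟨r, by omega⟩, Finset.mem_univ _, rfl⟩
  rw [h3, Submodule.mem_bot] at h4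
  exact congrFun h4 ⟨r, hr⟩

end Pending

/-! ### Intersections for identifying vectors with the same prefix -/

section Distance

variable {F : Type*} [Field F] {k n i : ℕ}

theorem eq_zero_of_notMem_ferrersDiagram_vSuffix (hk : 3 ≤ k) (hi : i ∈ Finset.Icc 1 3)
    {y : Finset ℕ} (hy : y.card = 2) {a : ℕ → F} {B : Matrix (Fin k) (Fin (sA k + 2 - k)) F}
    (hB : ∀ r c, (r, c) ∉ blockDiagram k → B r c = 0) {M : Matrix (Fin k) (Fin (n - k)) F}
    (hM : ∀ r c, (r, c) ∉ lastDots k n (vSuffix i k y) → M r c = 0) (r : Fin k) (c : Fin (n - k))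
    (hrc : (r, c) ∉ ferrersDiagram k n (vSuffix i k y)) :
    (pendingFill k n i a B + M) r c = 0 := by
  rw [Finset.mem_Icc] at hi
  have hc := card_vSuffix (k := k) (i := i) (by omega) hi.1 hy
  rw [Matrix.add_apply, hM r c fun h => hrc (Finset.mem_filter.1 h).1, add_zero]
  refine pendingFill_eq_zero hB ?_
  by_contra! hcon
  rw [mem_ferrersDiagram hc] at hrc
  have := pivotCol_vSuffix (k := k) (i := i) (by omega) hi.1 y (r := r) (by omega)
  simp only at hrc
  have := le_sA hk
  omega

/-- For an element of two lifted subspaces with identifying vectors in the same `𝒜_i^k`, the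
coefficients of the rows of the echelon matrix annihilate the difference of the two pending
blocks, as the two vectors have the same prefix. -/
theorem sum_mul_pendingFill_sub_eq_zero (hk : 3 ≤ k) (hn : sA k + k + 2 ≤ n) (hi : 1 ≤ i)
    {y y' : Finset ℕ}
    (hy' : y' ∈ (Finset.range (n - sA k)).powersetCard 2)
    {a a' : ℕ → F} {B B' : Matrix (Fin k) (Fin (sA k + 2 - k)) F}
    (hB : ∀ r c, (r, c) ∉ blockDiagram k → B r c = 0)
    (hB' : ∀ r c, (r, c) ∉ blockDiagram k → B' r c = 0)
    {M M' : Matrix (Fin k) (Fin (n - k)) F}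
    (hM : ∀ r c, (r, c) ∉ lastDots k n (vSuffix i k y) → M r c = 0)
    (hM' : ∀ r c, (r, c) ∉ lastDots k n (vSuffix i k y') → M' r c = 0)
    (hv : vSuffix i k y ⊆ Finset.range n) (hc : (vSuffix i k y).card = k)
    {x : Fin n → F} (hx : x ∈ liftSubspace (vSuffix i k y) (pendingFill k n i a B + M))
    (hx' : x ∈ liftSubspace (vSuffix i k y') (pendingFill k n i a' B' + M'))
    (c : Fin (n - k)) (hcW : (c : ℕ) < sA k + 2 - k) :
    ∑ r, x (pivotIdx hv hc r) *
      (pendingFill k n i a B r c - pendingFill k n i a' B' r c) = 0 := by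
  rw [Finset.mem_powersetCard] at hy'
  have hs := le_sA hk
  have hv' : vSuffix i k y' ⊆ Finset.range n := by
    have := vSuffix_subset (k := k) (by omega) hi hy'.1
    rwa [show sA k + (n - sA k) = n by omega] at this
  have hc' := card_vSuffix (k := k) (i := i) (by omega) hi hy'.2
  have hpre := vSuffix_empty_subset (k := k) (by omega) hi
  have hprec := card_vSuffix_empty (k := k) (by omega) hi
  have h1 := (mem_liftSubspace_iff hv hc _ x).1 hx c
  have h2 := (mem_liftSubspace_iff hv' hc' _ x).1 hx' c
  have h3 : freeIdx hv hc c = freeIdx hv' hc' c := by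
    refine Fin.ext ?_
    change freeCol (vSuffix i k y) c = freeCol (vSuffix i k y') c
    rw [vSuffix_eq_concatVec (by omega) i y, vSuffix_eq_concatVec (by omega) i y',
      freeCol_concatVec_of_lt hpre (by omega), freeCol_concatVec_of_lt hpre (by omega)]
  rw [← h3, h1, Matrix.vecMul, Matrix.vecMul, dotProduct, dotProduct, ← sub_eq_zero,
    ← Finset.sum_sub_distrib] at h2
  rw [← h2]
  refine Finset.sum_congr rfl fun r _ => ?_
  rw [Matrix.add_apply, Matrix.add_apply, hM r c fun h => by
    have := ((mem_lastDots hc _).1 h).2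
    simp only at this
    omega, hM' r c fun h => by
    have := ((mem_lastDots hc' _).1 h).2
    simp only at this
    omega, add_zero, add_zero]
  by_cases hr : (r : ℕ) < k - 2
  · have h4 : pivotIdx hv hc r = pivotIdx hv' hc' r := by
      refine Fin.ext ?_
      change pivotCol (vSuffix i k y) r = pivotCol (vSuffix i k y') r
      rw [vSuffix_eq_concatVec (by omega) i y, vSuffix_eq_concatVec (by omega) i y',
        pivotCol_concatVec_of_lt hpre (by omega), pivotCol_concatVec_of_lt hpre (by omega)]
    rw [h4, mul_sub]
  · rw [pendingFill_eq_zero hB (Or.inl (by omega)), pendingFill_eq_zero hB' (Or.inl (by omega))]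
    simp

/-- An element of a lifted subspace with identifying vector `(prefix || y)` whose coordinates
vanish at the first `k - 2` pivots has no nonzero coordinate at a common one of two identifying
vectors, unless it is a common one of the suffixes. -/
theorem eq_zero_at_common_one (hk : 3 ≤ k) (hi : 1 ≤ i) {y y' : Finset ℕ}
    (hv : vSuffix i k y ⊆ Finset.range n) (hc : (vSuffix i k y).card = k) {x : Fin n → F}
    (h : ∀ r : Fin k, (r : ℕ) < k - 2 → x (pivotIdx hv hc r) = 0)
    (hx : ∀ c : Fin n, (c : ℕ) - sA k ∈ y ∩ y' → sA k ≤ (c : ℕ) → x c = 0)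
    (c : Fin n) (hcv : (c : ℕ) ∈ vSuffix i k y ∩ vSuffix i k y') : x c = 0 := by
  obtain ⟨h1, h2⟩ := Finset.mem_inter.1 hcv
  obtain ⟨r, hrc⟩ := exists_pivotIdx_eq hv hc h1
  by_cases hr : (r : ℕ) < k - 2
  · exact hrc ▸ h r hr
  · have hpre := vSuffix_empty_subset (k := k) (by omega) hi
    have hprec := card_vSuffix_empty (k := k) (by omega) hi
    have h3 : sA k ≤ (c : ℕ) := by
      by_contra! hlt
      have h4 := count_concatVec (y := y) hpre 0
      rw [← vSuffix_eq_concatVec (by omega), add_zero, hprec, Nat.count_zero, add_zero] at h4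
      have h5 := Nat.count_strict_mono (p := fun a => a ∈ vSuffix i k y) h1 hlt
      rw [show (c : ℕ) = pivotCol (vSuffix i k y) r from congrArg Fin.val hrc,
        count_pivotCol (r.2.trans_eq hc.symm), h4] at h5
      omega
    rw [vSuffix_eq_concatVec (by omega) i y] at h1
    rw [vSuffix_eq_concatVec (by omega) i y'] at h2
    have hnot : (c : ℕ) ∉ vSuffix i k ∅ := fun h => by
      have := Finset.mem_range.1 (hpre h)
      omega
    refine hx _ (Finset.mem_inter.2 ⟨?_, ?_⟩) h3
    · exact ((mem_concatVec.1 h1).resolve_left hnot).2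
    · exact ((mem_concatVec.1 h2).resolve_left hnot).2

/-- Two distinct vectors in the same `𝒜_i^k` have `k - 2` common ones in their prefixes; the
pending blocks make up for them. -/
theorem finrank_inf_vSuffix_le_one (hk : 4 ≤ k) (hn : sA k + k + 2 ≤ n) (hi : i ∈ Finset.Icc 1 3)
    {y y' : Finset ℕ} (hy : y ∈ (Finset.range (n - sA k)).powersetCard 2)
    (hy' : y' ∈ (Finset.range (n - sA k)).powersetCard 2)
    {a a' : ℕ → F} {B B' : Matrix (Fin k) (Fin (sA k + 2 - k)) F}
    (hB : ∀ r c, (r, c) ∉ blockDiagram k → B r c = 0)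
    (hB' : ∀ r c, (r, c) ∉ blockDiagram k → B' r c = 0)
    {M M' : Matrix (Fin k) (Fin (n - k)) F}
    (hM : ∀ r c, (r, c) ∉ lastDots k n (vSuffix i k y) → M r c = 0)
    (hM' : ∀ r c, (r, c) ∉ lastDots k n (vSuffix i k y') → M' r c = 0)
    (h : (a = a' ∧ Disjoint y y' ∧ k - 3 ≤ (B - B').rank) ∨
      ((∃ e < i - 1, a e ≠ a' e) ∧ (y ∩ y').card ≤ 1)) :
    Module.finrank F (liftSubspace (vSuffix i k y) (pendingFill k n i a B + M) ⊓
      liftSubspace (vSuffix i k y') (pendingFill k n i a' B' + M') :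
        Submodule F (Fin n → F)) ≤ 1 := by
  obtain ⟨hi1, hi3⟩ := Finset.mem_Icc.1 hi
  have hsub : ∀ z ∈ (Finset.range (n - sA k)).powersetCard 2,
      vSuffix i k z ⊆ Finset.range n := fun z hz => by
    have := vSuffix_subset (k := k) (by omega) hi1 (Finset.mem_powersetCard.1 hz).1
    rwa [show sA k + (n - sA k) = n by omega] at this
  have hcard : ∀ z ∈ (Finset.range (n - sA k)).powersetCard 2,
      (vSuffix i k z).card = k := fun z hz =>
    card_vSuffix (by omega) hi1 (Finset.mem_powersetCard.1 hz).2
  have hv := hsub y hy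
  have hc := hcard y hy
  have hT := eq_zero_of_notMem_ferrersDiagram_vSuffix (by omega) hi (Finset.mem_powersetCard.1 hy).2
    (a := a) hB hM
  have hT' := eq_zero_of_notMem_ferrersDiagram_vSuffix (by omega) hi
    (Finset.mem_powersetCard.1 hy').2 (a := a') hB' hM'
  rcases h with ⟨rfl, hdisj, hrank⟩ | ⟨⟨e, he, hne⟩, hcap⟩
  · -- the first `k - 3` coefficients vanish, and only the next one is left
    refine (finrank_le_card_of_forall_eq_zero _ {pivotCol (vSuffix i k y) (k - 3)}
      fun x hx h0 => ?_).trans (Finset.card_singleton _).le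
    have hsum := sum_mul_pendingFill_sub_eq_zero (by omega) hn hi1 hy' hB hB' hM hM' hv hc
      hx.1 hx.2
    have hker : Matrix.vecMul (fun r => x (pivotIdx hv hc r)) (B - B') = 0 := by
      funext c
      have := hsum ⟨c, by have := c.2; omega⟩ c.2
      rw [Matrix.vecMul, dotProduct, Pi.zero_apply, ← this]
      refine Finset.sum_congr rfl fun r _ => ?_
      exact congrArg _ (pendingFill_sub_pendingFill hB hB' r ⟨(c : ℕ), _⟩ c.2).symm
    have hrow := eq_zero_of_vecMul_eq_zero_of_le_rank (ρ := k - 3) (by omega) (fun r c hr => by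
      have hnot : (r, c) ∉ blockDiagram k := by
        simp only [blockDiagram, Finset.mem_filter, Finset.mem_univ, true_and]
        rw [rowLen_eq_zero (by omega)]
        omega
      rw [Matrix.sub_apply, hB r c hnot, hB' r c hnot, sub_self]) hrank hker
    refine eq_zero_of_mem_inf_liftSubspace hv hc _ _ (hsub y' hy') (hcard y' hy') hT hT' hx.1 hx.2
      (eq_zero_at_common_one (by omega) hi1 hv hc (fun r hr => ?_) fun c hcy _ => ?_)
    · by_cases hr' : (r : ℕ) < k - 3
      · exact hrow r hr'
      · refine h0 _ (Finset.mem_singleton.2 ?_)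
        change pivotCol _ r = _
        rw [show (r : ℕ) = k - 3 by omega]
    · rw [Finset.disjoint_iff_inter_eq_empty.1 hdisj] at hcy
      exact absurd hcy (Finset.notMem_empty _)
  · refine (finrank_le_card_of_forall_eq_zero _ ((y ∩ y').map (addLeftEmbedding (sA k)))
      fun x hx h0 => ?_).trans ((Finset.card_map _).trans_le hcap)
    have hrow := eq_zero_of_sum_mul_pendingFill_sub_eq_zero (by omega) (by omega) hi3 hB hB' he hne
      (fun r => x (pivotIdx hv hc r))
      (sum_mul_pendingFill_sub_eq_zero (by omega) hn hi1 hy' hB hB' hM hM' hv hc hx.1 hx.2)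
    refine eq_zero_of_mem_inf_liftSubspace hv hc _ _ (hsub y' hy') (hcard y' hy') hT hT' hx.1 hx.2
      (eq_zero_at_common_one (by omega) hi1 hv hc hrow fun c hcy hcs => h0 c ?_)
    exact Finset.mem_map.2 ⟨_, hcy, by simp only [addLeftEmbedding_apply]; omega⟩

end Distance

/-! ### The code of Construction A -/

theorem IsOneFactorization.sum_sum_eq {m : ℕ} {P : ℕ → Finset (Finset ℕ)}
    (hP : IsOneFactorization m P) (f : Finset ℕ → ℕ) :
    ∑ t ∈ Finset.Icc 1 (numClasses m), ∑ y ∈ P t, f y =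
      ∑ y ∈ (Finset.range m).powersetCard 2, f y := by
  rw [← Finset.sum_biUnion]
  · refine Finset.sum_congr (Finset.ext fun y => ?_) fun _ _ => rfl
    rw [Finset.mem_biUnion]
    constructor
    · rintro ⟨t, ht, hy⟩
      exact hP.mem t ht y hy
    · intro hy
      obtain ⟨t, ht, -⟩ := hP.existsUnique y hy
      exact ⟨t, ht⟩
  · intro t ht t' ht' hne
    rw [Function.onFun, Finset.disjoint_left]
    intro y hy hy'
    exact hne ((hP.existsUnique y (hP.mem t ht y hy)).unique ⟨ht, hy⟩ ⟨ht', hy'⟩)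

section Code

namespace ConstructionA

variable {F : Type*} [Field F] [Fintype F] {k n : ℕ} (A : ConstructionA F k n)

/-- The indices of the identifying vectors: `j` for `v_{0j}^k`, and the pairs of a class and one of
its suffixes for the vectors in `𝒜_1^k ∪ 𝒜_2^k ∪ 𝒜_3^k`. -/
def index : Finset (ℕ ⊕ Σ _ : ℕ, Finset ℕ) :=
  (Finset.range (k - 2)).disjSum ((Finset.Icc 1 (numClasses (n - sA k))).sigma A.P)

/-- The part of the code with the given identifying vector. -/
def part : (ℕ ⊕ Σ _ : ℕ, Finset ℕ) → Set (Submodule F (Fin n → F)) :=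
  Sum.elim A.partZero fun p => A.partSuffix p.1 p.2

theorem code_eq_biUnion : A.code = ⋃ a ∈ A.index, A.part a := by
  ext X
  simp only [code, index, part, Set.mem_union, Set.mem_iUnion, Finset.mem_disjSum,
    Finset.mem_sigma, exists_prop]
  constructor
  · rintro (⟨j, hj, hX⟩ | ⟨t, ht, y, hy, hX⟩)
    · exact ⟨Sum.inl j, Or.inl ⟨j, hj, rfl⟩, hX⟩
    · exact ⟨Sum.inr ⟨t, y⟩, Or.inr ⟨_, ⟨ht, hy⟩, rfl⟩, hX⟩
  · rintro ⟨_, ⟨j, hj, rfl⟩ | ⟨p, ⟨ht, hy⟩, rfl⟩, hX⟩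
    · exact Or.inl ⟨j, hj, hX⟩
    · exact Or.inr ⟨p.1, ht, p.2, hy, hX⟩

theorem vZero_subset_range (hk : 3 ≤ k) (hn : sA k + k + 2 ≤ n) {j : ℕ}
    (hj : j ∈ Finset.range (k - 2)) : vZero A.w k j ⊆ Finset.range n := by
  have hj' : j + 3 ≤ k := by have := Finset.mem_range.1 hj; omega
  refine (vZero_subset hj' A.w_lt).trans (Finset.range_subset_range.2 ?_)
  have := sum_Icc_sub_le_sA hj'
  omega

theorem vSuffix_subset_range (hk : 3 ≤ k) (hn : sA k + k + 2 ≤ n) {t : ℕ} {y : Finset ℕ}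
    (ht : t ∈ Finset.Icc 1 (numClasses (n - sA k))) (hy : y ∈ A.P t) :
    vSuffix (classLevel (Fintype.card F) t) k y ⊆ Finset.range n ∧
      (vSuffix (classLevel (Fintype.card F) t) k y).card = k := by
  have h1 := Finset.mem_powersetCard.1 (A.isOneFactorization.mem t ht y hy)
  have hi := (Finset.mem_Icc.1 (classLevel_mem (Fintype.card F) t)).1
  refine ⟨?_, card_vSuffix (by omega) hi h1.2⟩
  have := vSuffix_subset (k := k) (by omega) hi h1.1
  rwa [show sA k + (n - sA k) = n by omega] at this

theorem finrank_codeZero (hk : 3 ≤ k) (hn : sA k + k + 2 ≤ n) {j : ℕ}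
    (hj : j ∈ Finset.range (k - 2)) :
    Module.finrank F (A.codeZero j) = 2 * (n - ∑ i ∈ Finset.Icc (k - j) k, i) := by
  rw [(A.codeZero_isFDMRD j hj).finrank_eq]
  exact (isFDMRD_vZero F hk hn (by have := Finset.mem_range.1 hj; omega) A.w_lt).2

theorem finrank_codeSuffix (hk : 3 ≤ k) (hn : sA k + k + 2 ≤ n) {t : ℕ} {y : Finset ℕ}
    (ht : t ∈ Finset.Icc 1 (numClasses (n - sA k))) (hy : y ∈ A.P t) :
    Module.finrank F (A.codeSuffix y) = 2 * (n - sA k) - 3 - ∑ c ∈ y, c := by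
  rw [(A.codeSuffix_isFDMRD t ht y hy).finrank_eq]
  exact (isFDMRD_vSuffix F hk hn (Finset.mem_Icc.1 (classLevel_mem (Fintype.card F) t)).1
    (A.isOneFactorization.mem t ht y hy)).2

theorem finrank_of_mem_part (hk : 3 ≤ k) (hn : sA k + k + 2 ≤ n)
    {a : ℕ ⊕ Σ _ : ℕ, Finset ℕ} (ha : a ∈ A.index) {X : Submodule F (Fin n → F)}
    (hX : X ∈ A.part a) : Module.finrank F X = k := by
  rcases Finset.mem_disjSum.1 ha with ⟨j, hj, rfl⟩ | ⟨⟨t, y⟩, hp, rfl⟩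
  · obtain ⟨M, hM, rfl⟩ := hX
    exact finrank_liftSubspace (A.vZero_subset_range hk hn hj)
      (card_vZero (by have := Finset.mem_range.1 hj; omega) A.w_lt) _
  · obtain ⟨ht, hy⟩ := Finset.mem_sigma.1 hp
    obtain ⟨M, hM, rfl⟩ := hX
    obtain ⟨h1, h2⟩ := A.vSuffix_subset_range hk hn ht hy
    exact finrank_liftSubspace h1 h2 _

theorem finrank_inf_le_one_of_lt (hk : 4 ≤ k) (hn : sA k + k + 2 ≤ n) {j j' : ℕ}
    (hj : j ∈ Finset.range (k - 2)) (hj' : j' ∈ Finset.range (k - 2)) (hlt : j < j')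
    {X Y : Submodule F (Fin n → F)} (hX : X ∈ A.partZero j) (hY : Y ∈ A.partZero j') :
    Module.finrank F (X ⊓ Y : Submodule F (Fin n → F)) ≤ 1 := by
  obtain ⟨M, hM, rfl⟩ := hX
  obtain ⟨M', hM', rfl⟩ := hY
  have h1 : j + 3 ≤ k := by have := Finset.mem_range.1 hj; omega
  have h2 : j' + 3 ≤ k := by have := Finset.mem_range.1 hj'; omega
  exact (finrank_inf_liftSubspace_le (A.vZero_subset_range (by omega) hn hj)
    (card_vZero h1 A.w_lt) (A.vZero_subset_range (by omega) hn hj') (card_vZero h2 A.w_lt)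
    ((A.codeZero_isFDMRD j hj).eq_zero M hM) ((A.codeZero_isFDMRD j' hj').eq_zero M' hM')).trans
    (card_vZero_inter_vZero hlt h2 A.w_lt A.w_inj)

theorem finrank_inf_le_one_of_partZero (hk : 4 ≤ k) (hn : sA k + k + 2 ≤ n) {j j' : ℕ}
    (hj : j ∈ Finset.range (k - 2)) (hj' : j' ∈ Finset.range (k - 2))
    {X Y : Submodule F (Fin n → F)} (hX : X ∈ A.partZero j) (hY : Y ∈ A.partZero j')
    (h : j = j' → X ≠ Y) :
    Module.finrank F (X ⊓ Y : Submodule F (Fin n → F)) ≤ 1 := by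
  rcases lt_trichotomy j j' with hlt | rfl | hlt
  · exact A.finrank_inf_le_one_of_lt hk hn hj hj' hlt hX hY
  · obtain ⟨M, hM, rfl⟩ := hX
    obtain ⟨M', hM', rfl⟩ := hY
    have h1 := finrank_inf_liftSubspace_add_rank (A.vZero_subset_range (by omega) hn hj)
      (card_vZero (by have := Finset.mem_range.1 hj; omega) A.w_lt) M M'
    have h2 := (A.codeZero_isFDMRD j hj).le_rank_sub M hM M' hM' fun e => h rfl (by rw [e])
    omega
  · rw [inf_comm]
    exact A.finrank_inf_le_one_of_lt hk hn hj' hj hlt hY hX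

theorem eq_zero_of_mem_codeSuffix (hk : 3 ≤ k) {t : ℕ} {y : Finset ℕ}
    (ht : t ∈ Finset.Icc 1 (numClasses (n - sA k))) (hy : y ∈ A.P t)
    {M : Matrix (Fin k) (Fin (n - k)) F} (hM : M ∈ A.codeSuffix y) (r : Fin k) (c : Fin (n - k))
    (hrc : (r, c) ∉ ferrersDiagram k n (vSuffix (classLevel (Fintype.card F) t) k y)) :
    (pendingFill k n (classLevel (Fintype.card F) t) (A.label t) (A.block y) + M) r c = 0 :=
  eq_zero_of_notMem_ferrersDiagram_vSuffix hk (classLevel_mem _ _)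
    (Finset.mem_powersetCard.1 (A.isOneFactorization.mem t ht y hy)).2
    ((A.blockCode_isFDMRD t ht).eq_zero _ (A.block_mem t ht y hy))
    ((A.codeSuffix_isFDMRD t ht y hy).eq_zero M hM) r c hrc

theorem finrank_inf_le_one_of_partZero_partSuffix (hk : 4 ≤ k) (hn : sA k + k + 2 ≤ n) {j t : ℕ}
    {y : Finset ℕ} (hj : j ∈ Finset.range (k - 2))
    (ht : t ∈ Finset.Icc 1 (numClasses (n - sA k))) (hy : y ∈ A.P t)
    {X Y : Submodule F (Fin n → F)} (hX : X ∈ A.partZero j) (hY : Y ∈ A.partSuffix t y) :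
    Module.finrank F (X ⊓ Y : Submodule F (Fin n → F)) ≤ 1 := by
  obtain ⟨M, hM, rfl⟩ := hX
  obtain ⟨M', hM', rfl⟩ := hY
  have h1 : j + 3 ≤ k := by have := Finset.mem_range.1 hj; omega
  obtain ⟨hv, hc⟩ := A.vSuffix_subset_range (by omega) hn ht hy
  exact (finrank_inf_liftSubspace_le (A.vZero_subset_range (by omega) hn hj)
    (card_vZero h1 A.w_lt) hv hc ((A.codeZero_isFDMRD j hj).eq_zero M hM)
    (A.eq_zero_of_mem_codeSuffix (by omega) ht hy hM')).trans
    (card_vZero_inter_vSuffix h1 A.w_lt (Finset.mem_Icc.1 (classLevel_mem _ t)).1 y)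

theorem card_inter_le_one {y y' : Finset ℕ} (hy : y.card = 2) (hy' : y'.card = 2) (hne : y ≠ y') :
    (y ∩ y').card ≤ 1 := by
  by_contra! h
  have h1 := Finset.eq_of_subset_of_card_le (Finset.inter_subset_left (s₁ := y) (s₂ := y'))
    (by omega)
  have h2 := Finset.eq_of_subset_of_card_le (Finset.inter_subset_right (s₁ := y) (s₂ := y'))
    (by omega)
  exact hne (h1.symm.trans h2)

theorem finrank_inf_le_one_of_partSuffix (hk : 4 ≤ k) (hn : sA k + k + 2 ≤ n) {t t' : ℕ}
    {y y' : Finset ℕ} (ht : t ∈ Finset.Icc 1 (numClasses (n - sA k))) (hy : y ∈ A.P t)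
    (ht' : t' ∈ Finset.Icc 1 (numClasses (n - sA k))) (hy' : y' ∈ A.P t')
    {X Y : Submodule F (Fin n → F)} (hX : X ∈ A.partSuffix t y) (hY : Y ∈ A.partSuffix t' y')
    (h : t = t' → y = y' → X ≠ Y) :
    Module.finrank F (X ⊓ Y : Submodule F (Fin n → F)) ≤ 1 := by
  obtain ⟨M, hM, rfl⟩ := hX
  obtain ⟨M', hM', rfl⟩ := hY
  have hm := A.isOneFactorization.mem t ht y hy
  have hm' := A.isOneFactorization.mem t' ht' y' hy'
  obtain ⟨hv, hc⟩ := A.vSuffix_subset_range (by omega) hn ht hy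
  by_cases hyy : y = y'
  · subst hyy
    obtain rfl := (A.isOneFactorization.existsUnique y hm).unique ⟨ht, hy⟩ ⟨ht', hy'⟩
    have h1 := finrank_inf_liftSubspace_add_rank hv hc
      (pendingFill k n (classLevel (Fintype.card F) t) (A.label t) (A.block y) + M)
      (pendingFill k n (classLevel (Fintype.card F) t) (A.label t) (A.block y) + M')
    rw [add_sub_add_left_eq_sub] at h1
    have h2 := (A.codeSuffix_isFDMRD t ht y hy).le_rank_sub M hM M' hM'
      fun e => h rfl rfl (by rw [e])
    omega
  have hcap := card_inter_le_one (Finset.mem_powersetCard.1 hm).2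
    (Finset.mem_powersetCard.1 hm').2 hyy
  by_cases hlev : classLevel (Fintype.card F) t = classLevel (Fintype.card F) t'
  · have hzero := (A.codeSuffix_isFDMRD t' ht' y' hy').eq_zero M' hM'
    rw [← hlev] at hzero ⊢
    refine finrank_inf_vSuffix_le_one hk hn (classLevel_mem _ _) hm hm'
      ((A.blockCode_isFDMRD t ht).eq_zero _ (A.block_mem t ht y hy))
      ((A.blockCode_isFDMRD t' ht').eq_zero _ (A.block_mem t' ht' y' hy'))
      ((A.codeSuffix_isFDMRD t ht y hy).eq_zero M hM) hzero ?_
    by_cases htt : t = t'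
    · subst htt
      exact Or.inl ⟨rfl, A.isOneFactorization.disjoint t ht y hy y' hy' hyy,
        (A.blockCode_isFDMRD t ht).le_rank_sub _ (A.block_mem t ht y hy) _
          (A.block_mem t ht y' hy') fun e => hyy (A.block_inj t ht hy hy' e)⟩
    · exact Or.inr ⟨A.label_ne t ht t' ht' htt hlev, hcap⟩
  · obtain ⟨hv', hc'⟩ := A.vSuffix_subset_range (by omega) hn ht' hy'
    refine (finrank_inf_liftSubspace_le hv hc hv' hc'
      (A.eq_zero_of_mem_codeSuffix (by omega) ht hy hM)
      (A.eq_zero_of_mem_codeSuffix (by omega) ht' hy' hM')).trans ?_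
    have h1 := (Finset.mem_Icc.1 (classLevel_mem (Fintype.card F) t)).1
    have h2 := (Finset.mem_Icc.1 (classLevel_mem (Fintype.card F) t')).1
    rw [vSuffix_eq_concatVec (by omega) _ y, vSuffix_eq_concatVec (by omega) _ y',
      concatVec_inter (vSuffix_empty_subset (by omega) h1) (vSuffix_empty_subset (by omega) h2),
      vSuffix_empty_inter (by omega) (classLevel_mem _ _) (classLevel_mem _ _) hlev,
      card_concatVec (by simp), Finset.card_empty, zero_add]
    exact hcap

/-- Codewords from different parts, as well as distinct codewords from one part, intersect in a space
of dimension at most one. Since `k > 1`, this also shows that the parts are disjoint. -/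
theorem finrank_inf_le_one (hk : 4 ≤ k) (hn : sA k + k + 2 ≤ n)
    {a b : ℕ ⊕ Σ _ : ℕ, Finset ℕ} (ha : a ∈ A.index) (hb : b ∈ A.index)
    {X Y : Submodule F (Fin n → F)} (hX : X ∈ A.part a) (hY : Y ∈ A.part b) (h : a = b → X ≠ Y) :
    Module.finrank F (X ⊓ Y : Submodule F (Fin n → F)) ≤ 1 := by
  rcases Finset.mem_disjSum.1 ha with ⟨j, hj, rfl⟩ | ⟨⟨t, y⟩, hp, rfl⟩ <;>
    rcases Finset.mem_disjSum.1 hb with ⟨j', hj', rfl⟩ | ⟨⟨t', y'⟩, hp', rfl⟩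
  · exact A.finrank_inf_le_one_of_partZero hk hn hj hj' hX hY fun e => h (by rw [e])
  · obtain ⟨ht, hy⟩ := Finset.mem_sigma.1 hp'
    exact A.finrank_inf_le_one_of_partZero_partSuffix hk hn hj ht hy hX hY
  · obtain ⟨ht, hy⟩ := Finset.mem_sigma.1 hp
    rw [inf_comm]
    exact A.finrank_inf_le_one_of_partZero_partSuffix hk hn hj' ht hy hY hX
  · obtain ⟨ht, hy⟩ := Finset.mem_sigma.1 hp
    obtain ⟨ht', hy'⟩ := Finset.mem_sigma.1 hp'
    exact A.finrank_inf_le_one_of_partSuffix hk hn ht hy ht' hy' hX hY fun e e' =>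
      h (congrArg Sum.inr (Sigma.ext e (heq_of_eq e')))

/-- The lower bound `k - 1` for the distance is attained in the lifted MRD code, which has more
codewords than a code with minimum rank distance `k` can have. -/
theorem isLeast_injDist (hk : 4 ≤ k) (hn : sA k + k + 2 ≤ n) :
    IsLeast {e | ∃ X ∈ A.code, ∃ Y ∈ A.code, X ≠ Y ∧ injDist X Y = e} (k - 1) := by
  constructor
  · have hj : 0 ∈ Finset.range (k - 2) := Finset.mem_range.2 (by omega)
    have hv := A.vZero_subset_range (by omega) hn hj
    have hc := card_vZero (k := k) (j := 0) (by omega) A.w_lt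
    have hdim := A.finrank_codeZero (by omega) hn hj
    have hrank := fun M (hM : M ∈ A.codeZero 0) => (A.codeZero_isFDMRD 0 hj).le_rank hM
    obtain ⟨M, hM, hM0, hlt⟩ : ∃ M ∈ A.codeZero 0, M ≠ 0 ∧ M.rank < k := by
      by_contra! hcon
      have h1 := finrank_le_dotsOutside (d := k) (i := k - 1) (by omega)
        (A.codeZero_isFDMRD 0 hj).eq_zero hcon
      have h2 : dotsOutside (ferrersDiagram k n (vZero A.w k 0)) k (k - 1) ≤
          (Finset.univ : Finset (Fin (n - k))).card := by
        refine Finset.card_le_card_of_injOn (fun p => p.2) (fun _ _ => Finset.mem_univ _) ?_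
        rintro ⟨r, c⟩ hp ⟨r', c'⟩ hp' e
        have e1 := (Finset.mem_filter.1 hp).2.1
        have e2 := (Finset.mem_filter.1 hp').2.1
        simp only at e1 e2
        exact Prod.ext (Fin.ext (by simp only; omega)) e
      rw [Finset.card_univ, Fintype.card_fin] at h2
      rw [Nat.sub_zero, Finset.Icc_self, Finset.sum_singleton] at hdim
      omega
    have hmem : ∀ M ∈ A.codeZero 0, liftSubspace (vZero A.w k 0) M ∈ A.code := fun M hM => by
      rw [code_eq_biUnion]
      refine Set.mem_biUnion (x := Sum.inl 0) ?_ ⟨M, hM, rfl⟩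
      exact Finset.mem_disjSum.2 (Or.inl ⟨0, hj, rfl⟩)
    refine ⟨_, hmem M hM, _, hmem 0 (Submodule.zero_mem _),
      fun e => hM0 (liftSubspace_injective hv hc e), ?_⟩
    have h3 := finrank_inf_liftSubspace_add_rank hv hc M 0
    have h4 := hrank M hM hM0
    rw [sub_zero] at h3
    rw [injDist, finrank_liftSubspace hv hc, finrank_liftSubspace hv hc, max_self]
    omega
  · rintro _ ⟨X, hX, Y, hY, hne, rfl⟩
    rw [code_eq_biUnion] at hX hY
    simp only [Set.mem_iUnion] at hX hY
    obtain ⟨a, ha, hX⟩ := hX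
    obtain ⟨b, hb, hY⟩ := hY
    have h1 := A.finrank_inf_le_one hk hn ha hb hX hY fun _ => hne
    rw [injDist, A.finrank_of_mem_part (by omega) hn ha hX,
      A.finrank_of_mem_part (by omega) hn hb hY, max_self]
    omega

/-! ### The cardinality of the code -/

theorem ncard_partZero (hk : 3 ≤ k) (hn : sA k + k + 2 ≤ n) {j : ℕ}
    (hj : j ∈ Finset.range (k - 2)) :
    (A.partZero j).ncard = Fintype.card F ^ (2 * (n - ∑ i ∈ Finset.Icc (k - j) k, i)) := by
  have h1 : A.partZero j =
      liftSubspace (vZero A.w k j) '' (A.codeZero j : Set (Matrix (Fin k) (Fin (n - k)) F)) := by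
    ext X
    exact exists_congr fun M => and_congr_right fun _ => eq_comm
  rw [h1, Set.ncard_image_of_injective _ (liftSubspace_injective (A.vZero_subset_range hk hn hj)
    (card_vZero (by have := Finset.mem_range.1 hj; omega) A.w_lt)), ← Nat.card_coe_set_eq,
    ← A.finrank_codeZero hk hn hj, ← Nat.card_eq_fintype_card]
  exact Module.natCard_eq_pow_finrank

theorem ncard_partSuffix (hk : 3 ≤ k) (hn : sA k + k + 2 ≤ n) {t : ℕ} {y : Finset ℕ}
    (ht : t ∈ Finset.Icc 1 (numClasses (n - sA k))) (hy : y ∈ A.P t) :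
    (A.partSuffix t y).ncard = Fintype.card F ^ (2 * (n - sA k) - 3 - ∑ c ∈ y, c) := by
  obtain ⟨hv, hc⟩ := A.vSuffix_subset_range hk hn ht hy
  have h1 : A.partSuffix t y = (fun M => liftSubspace (vSuffix (classLevel (Fintype.card F) t) k y)
      (pendingFill k n (classLevel (Fintype.card F) t) (A.label t) (A.block y) + M)) ''
        (A.codeSuffix y : Set (Matrix (Fin k) (Fin (n - k)) F)) := by
    ext X
    exact exists_congr fun M => and_congr_right fun _ => eq_comm
  rw [h1, Set.ncard_image_of_injective _ (fun M M' e => add_left_cancel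
    (liftSubspace_injective hv hc e)), ← Nat.card_coe_set_eq,
    ← A.finrank_codeSuffix hk hn ht hy, ← Nat.card_eq_fintype_card]
  exact Module.natCard_eq_pow_finrank

theorem ncard_code (hk : 4 ≤ k) (hn : sA k + k + 2 ≤ n) :
    A.code.ncard =
      ∑ j ∈ Finset.range (k - 2), Fintype.card F ^ (2 * (n - ∑ i ∈ Finset.Icc (k - j) k, i)) +
      ∑ y ∈ (Finset.range (n - sA k)).powersetCard 2,
        Fintype.card F ^ (2 * (n - sA k) - 3 - ∑ c ∈ y, c) := by
  classical
  have hfin : ∀ a, (A.part a).Finite := fun a => Set.toFinite _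
  have h1 : A.code = (A.index.biUnion fun a => (hfin a).toFinset : Finset _) := by
    rw [code_eq_biUnion]
    simp
  rw [h1, Set.ncard_coe_finset, Finset.card_biUnion]
  · simp only [← Set.ncard_eq_toFinset_card]
    rw [index, Finset.sum_disjSum, Finset.sum_sigma]
    congr 1
    · exact Finset.sum_congr rfl fun j hj => A.ncard_partZero (by omega) hn hj
    · rw [← A.isOneFactorization.sum_sum_eq]
      exact Finset.sum_congr rfl fun t ht => Finset.sum_congr rfl fun y hy =>
        A.ncard_partSuffix (by omega) hn ht hy
  · intro a ha b hb hab
    rw [Function.onFun, Finset.disjoint_left]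
    intro X hX hX'
    rw [Set.Finite.mem_toFinset] at hX hX'
    have h2 := A.finrank_inf_le_one hk hn ha hb hX hX' fun e => absurd e hab
    rw [inf_idem, A.finrank_of_mem_part (by omega) hn ha hX] at h2
    omega

end ConstructionA

end Code

/-- The pairs in `{0, …, m}` are those without `0`, shifted by one, and the pairs `{0, b + 1}`. -/
theorem sum_pairs_range_succ {α : Type*} [AddCommMonoid α] (m : ℕ) (f : ℕ → α) :
    ∑ y ∈ (Finset.range (m + 1)).powersetCard 2, f (∑ c ∈ y, c) =
      ∑ y ∈ (Finset.range m).powersetCard 2, f (∑ c ∈ y, c + 2) +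
        ∑ b ∈ Finset.range m, f (b + 1) := by
  have h0 : (0 : ℕ) ∉ (Finset.range m).map (addRightEmbedding 1) := by simp
  have hr : Finset.range (m + 1) = insert 0 ((Finset.range m).map (addRightEmbedding 1)) := by
    ext c
    cases c <;> simp
  have hsum : ∀ y : Finset ℕ, ∑ c ∈ y.map (addRightEmbedding 1), c = ∑ c ∈ y, c + y.card :=
    fun y => by
      rw [Finset.sum_map]
      simp [Finset.sum_add_distrib]
  rw [hr, Finset.powersetCard_succ_insert h0, Finset.sum_union, Finset.powersetCard_map,
    Finset.sum_map]
  · congr 1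
    · refine Finset.sum_congr rfl fun y hy => ?_
      rw [RelEmbedding.coe_toEmbedding, Finset.mapEmbedding_apply, hsum,
        (Finset.mem_powersetCard.1 hy).2]
    · rw [Finset.powersetCard_map, Finset.powersetCard_one, Finset.map_map, Finset.sum_image,
        Finset.sum_map]
      · refine Finset.sum_congr rfl fun b _ => ?_
        simp
      · intro x hx x' hx' h
        have hnot : ∀ z ∈ (Finset.range m).map (Function.Embedding.trans
            ⟨_, Finset.singleton_injective⟩ (Finset.mapEmbedding (addRightEmbedding 1)).toEmbedding),
            (0 : ℕ) ∉ z := by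
          intro z hz
          obtain ⟨b, -, rfl⟩ := Finset.mem_map.1 hz
          simp
        rw [← Finset.erase_insert (hnot x hx), h, Finset.erase_insert (hnot x' hx')]
  · rw [Finset.disjoint_left]
    intro y hy hy'
    obtain ⟨z, -, rfl⟩ := Finset.mem_image.1 hy'
    exact h0 ((Finset.mem_powersetCard.1 hy).1 (Finset.mem_insert_self 0 z))

/-- The Gaussian coefficient as a sum over pivot positions: the number of two-dimensional subspaces
of `F^m` with pivots in the two positions `y` is the indicated power of `q`. -/
theorem sum_pairs_pow_eq_gaussCoeff {q : ℚ} (hq : 1 < q) {m : ℕ} (hm : 1 ≤ m) :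
    ∑ y ∈ (Finset.range m).powersetCard 2, q ^ (2 * m - 3 - ∑ c ∈ y, c) = gaussCoeff q m 2 := by
  have hq1 : q - 1 ≠ 0 := by linarith
  have hq2 : q ^ 2 - 1 ≠ 0 := by nlinarith
  obtain ⟨m, rfl⟩ : ∃ m', m = m' + 1 := ⟨m - 1, by omega⟩
  have hg : gaussCoeff q (m + 1) 2 = (q ^ (m + 1) - 1) * (q ^ m - 1) / ((q ^ 2 - 1) * (q - 1)) := by
    rw [gaussCoeff, Finset.prod_range_succ, Finset.prod_range_one, div_mul_div_comm]
    simp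
  rw [hg]
  clear hg hm
  rw [eq_div_iff (mul_ne_zero hq2 hq1)]
  induction m with
  | zero => simp [Finset.powersetCard_eq_empty.2]
  | succ m ih =>
    rw [sum_pairs_range_succ (m + 1) fun c => q ^ (2 * (m + 1 + 1) - 3 - c)]
    have h1 : ∀ c, 2 * (m + 1 + 1) - 3 - (c + 2) = 2 * (m + 1) - 3 - c := fun c => by omega
    have h2 : ∑ b ∈ Finset.range (m + 1), q ^ (2 * (m + 1 + 1) - 3 - (b + 1)) =
        q ^ m * ∑ b ∈ Finset.range (m + 1), q ^ b := by
      rw [← Finset.sum_range_reflect, Finset.mul_sum]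
      refine Finset.sum_congr rfl fun b hb => ?_
      have := Finset.mem_range.1 hb
      rw [← pow_add]
      congr 1
      omega
    have h3 : (∑ b ∈ Finset.range (m + 1), q ^ b) * (q - 1) = q ^ (m + 1) - 1 := geom_sum_mul q _
    simp only [h1]
    rw [h2, add_mul, ih]
    linear_combination q ^ m * (q ^ 2 - 1) * h3

theorem sA_eq {k : ℕ} (hk : 3 ≤ k) : sA k = (k ^ 2 + k - 6) / 2 := by
  have h : 2 * sA k + 6 = k ^ 2 + k := by
    induction k, hk using Nat.le_induction with
    | base => rfl
    | succ k hk ih =>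
      rw [sA_succ (by omega)]
      linear_combination ih
  omega

theorem sum_range_reverse_eq {k : ℕ} (hk : 4 ≤ k) (f : ℕ → ℚ) :
    ∑ j ∈ Finset.range (k - 2), f (k - j) = f k + ∑ j ∈ Finset.Icc 3 (k - 1), f j := by
  obtain ⟨k, rfl⟩ : ∃ k', k = k' + 3 := ⟨k - 3, by omega⟩
  rw [show k + 3 - 2 = k + 1 by omega, Finset.sum_range_succ', Nat.sub_zero, add_comm]
  congr 1
  refine Finset.sum_nbij' (fun j => k + 2 - j) (fun j => k + 2 - j) ?_ ?_ ?_ ?_ ?_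
  · intro j hj
    rw [Finset.mem_range] at hj
    rw [Finset.mem_Icc]
    omega
  · intro j hj
    rw [Finset.mem_Icc] at hj
    rw [Finset.mem_range]
    omega
  · intro j hj
    rw [Finset.mem_range] at hj
    omega
  · intro j hj
    rw [Finset.mem_Icc] at hj
    omega
  · intro j _
    rw [show k + 3 - (j + 1) = k + 2 - j by omega]

theorem mainTheorem1 {F : Type*} [Field F] [Fintype F] (k n : ℕ) (hk : 4 ≤ k)
    (hn : (k ^ 2 + 3 * k - 2) / 2 ≤ n)
    (hq : numClasses (n - (k ^ 2 + k - 6) / 2) ≤ Fintype.card F ^ 2 + Fintype.card F + 1) :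
    Nonempty (ConstructionA F k n) ∧
    ∀ A : ConstructionA F k n,
      IsConstDimCode n
        ((Fintype.card F : ℚ) ^ (2 * (n - k)) +
          ∑ j ∈ Finset.Icc 3 (k - 1),
            (Fintype.card F : ℚ) ^ (2 * (n - ∑ i ∈ Finset.Icc j k, i)) +
          gaussCoeff (Fintype.card F) (n - (k ^ 2 + k - 6) / 2) 2)
        (k - 1) k A.code := by
  have hs := sA_eq (k := k) (by omega)
  have hn' : sA k + k + 2 ≤ n := by
    rw [hs]
    have : k ≤ k ^ 2 := by nlinarith
    omega
  rw [← hs] at hq ⊢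
  refine ⟨nonempty_constructionA F hk hn' hq, fun A => ⟨fun X hX => ?_, Set.toFinite _, ?_,
    A.isLeast_injDist hk hn'⟩⟩
  · rw [A.code_eq_biUnion] at hX
    simp only [Set.mem_iUnion] at hX
    obtain ⟨a, ha, hX⟩ := hX
    exact A.finrank_of_mem_part (by omega) hn' ha hX
  · rw [A.ncard_code hk hn', ← sum_pairs_pow_eq_gaussCoeff
      (by exact_mod_cast Fintype.one_lt_card) (by omega)]
    push_cast
    rw [sum_range_reverse_eq hk
      fun j => (Fintype.card F : ℚ) ^ (2 * (n - ∑ i ∈ Finset.Icc j k, i)), Finset.Icc_self,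
      Finset.sum_singleton]
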